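/- Let $V^{5,2}=\mathrm{SO}(5)/\mathrm{SO}(3)$ be the Stiefel manifold of orthonormal pairs $(u,v)$ in $\mathbb{R}^5$, where $\mathrm{SO}(5)$ acts by $g\cdot(u,v)=(gu,gv)$, with base point $o=(\varepsilon_1,\varepsilon_2)$ given by the first two standard basis vectors. With $E_{ij}$ the elementary $5\times5$ matrices, put $e_1=E_{12}-E_{21}$, $e_2=E_{13}-E_{31}$, $e_3=E_{14}-E_{41}$, $e_4=E_{15}-E_{51}$, $e_5=E_{23}-E_{32}$, $e_6=E_{24}-E_{42}$, $e_7=E_{25}-E_{52}$; the vectors $e_i\cdot o$ form a basis of $T_oV^{5,2}$, with dual basis $e^1,\dots,e^7$. A $\mathrm{G}_2$-structure on $V^{5,2}$ is a smooth $3$-form $\varphi$ such that every tangent space has a basis $f_1,\dots,f_7$ in which $$\varphi=f^{125}+f^{136}+f^{147}+f^{234}-f^{267}+f^{357}-f^{456},\qquad f^{ijk}=f^i\wedge f^j\wedge f^k .$$ It induces the metric for which such bases are orthonormal and the orientation for which $(w\lrcorner\varphi)\wedge(w\lrcorner\varphi)\wedge\varphi>0$ for all $w\neq0$ (volume form $-f^{1234567}$).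 Let $\psi=\ast\varphi$ be the Hodge dual. The $\mathrm{G}_2$-structure $\varphi$ is coclosed if $d\psi=0$. A coclosed $\varphi$ is purely coclosed if $d\varphi\wedge\varphi=0$, and nearly parallel if $d\varphi=4\psi$. For $(a,b,x,y,z)\in\mathbb{R}^5$ with $$a^2+by>0,\qquad b^2+ax>0,\qquad z\neq0,\qquad xy=ab, \tag{1}$$ put $$y_2=\frac{(b^2+ax)^{2/3}}{(a^2+by)^{1/3}},\qquad y_3=\frac{(a^2+by)^{2/3}}{(b^2+ax)^{1/3}},$$ $$p_1=\frac{x\sqrt{a^2+by}}{b^2+ax},\quad p_2=\frac{a}{\sqrt{a^2+by}},\quad p_3=\frac{b}{\sqrt{b^2+ax}},\quad p_4=\frac{y\sqrt{b^2+ax}}{a^2+by},$$ $$X^1=\frac{z}{\sqrt{y_2y_3}}\,e^1,\qquad X^i=\sqrt{y_2}\,e^i\ (i=2,3,4),\qquad X^i=\sqrt{y_3}\,e^i\ (i=5,6,7),$$ and let $\varphi_{a,b,x,y,z}$ be the $\mathrm{SO}(5)$-invariant $3$-form on $V^{5,2}$ whose value at $o$ is $$-X^1\wedge(X^{25}+X^{36}+X^{47})+p_1X^{234}+p_2(-X^{267}+X^{357}-X^{456})+p_3(X^{237}-X^{246}+X^{345})-p_4X^{567}.$$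 **Theorem.** 1. For all $(a,b,x,y,z)$ satisfying (1), $\varphi_{a,b,x,y,z}$ is a (well-defined) $\mathrm{SO}(5)$-invariant coclosed $\mathrm{G}_2$-structure. 2. $V^{5,2}$ carries no $\mathrm{SO}(5)$-invariant purely coclosed $\mathrm{G}_2$-structure. 3. $\varphi_{a,b,x,y,z}$ is nearly parallel if $x=a$, $y=b$, $a^2+b^2=\frac{27}{512}$ and $z=-\frac{9}{32}$. These $\mathrm{G}_2$-structures form an $S^1$-family: distinct points $(a,b)$ of the circle $a^2+b^2=\frac{27}{512}$ give distinct $3$-forms $\varphi_{a,b,a,b,-9/32}$. -/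

import Mathlib

open scoped Matrix ContDiff Topology

noncomputable section

namespace StiefelG2

/-! ### The Stiefel manifold of orthonormal 2-frames in `ℝ⁵` and its `SO(5)`-action -/

/-- Pairs of vectors of `ℝ⁵`, the ambient vector space of the Stiefel manifold. Only its structure
of finite-dimensional topological vector space matters. -/
abbrev Amb : Type := (Fin 5 → ℝ) × (Fin 5 → ℝ)

/-- `V^{5,2}`: the pairs `(u, v)` of vectors of `ℝ⁵` that are orthonormal for the Euclidean
inner product. -/
def Stiefel : Type :=
  {p : Amb // p.1 ⬝ᵥ p.1 = 1 ∧ p.2 ⬝ᵥ p.2 = 1 ∧ p.1 ⬝ᵥ p.2 = 0}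

/-- The tangent space of `V^{5,2}` at `(u, v)`, as a subspace of `ℝ⁵ × ℝ⁵`: the kernel of the
derivative of the (regular) defining equations `u·u = 1`, `v·v = 1`, `u·v = 0`. -/
def tangent (p : Stiefel) : Submodule ℝ Amb where
  carrier := {w | p.1.1 ⬝ᵥ w.1 = 0 ∧ p.1.2 ⬝ᵥ w.2 = 0 ∧ p.1.1 ⬝ᵥ w.2 + p.1.2 ⬝ᵥ w.1 = 0}
  zero_mem' := by simp
  add_mem' := by
    rintro w w' ⟨h1, h2, h3⟩ ⟨h1', h2', h3'⟩
    refine ⟨?_, ?_, ?_⟩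
    · simp [dotProduct_add, h1, h1']
    · simp [dotProduct_add, h2, h2']
    · simp only [Prod.fst_add, Prod.snd_add, dotProduct_add]
      linarith
  smul_mem' := by
    rintro c w ⟨h1, h2, h3⟩
    refine ⟨?_, ?_, ?_⟩
    · simp [h1]
    · simp [h2]
    · simp only [Prod.smul_fst, Prod.smul_snd, dotProduct_smul, smul_eq_mul]
      rw [← mul_add, h3, mul_zero]

/-- A `5 × 5` matrix acts on pairs of vectors by `A (u, v) = (A u, A v)`. -/
def act (A : Matrix (Fin 5) (Fin 5) ℝ) : Amb →ₗ[ℝ] Amb :=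
  A.mulVecLin.prodMap A.mulVecLin

theorem act_apply (A : Matrix (Fin 5) (Fin 5) ℝ) (w : Amb) : act A w = (A *ᵥ w.1, A *ᵥ w.2) := rfl

/-- The rotation group. -/
abbrev SO5 : Type := Matrix.specialOrthogonalGroup (Fin 5) ℝ

theorem dotProduct_rot (g : SO5) (u v : Fin 5 → ℝ) : (g.1 *ᵥ u) ⬝ᵥ (g.1 *ᵥ v) = u ⬝ᵥ v := by
  have h : (g.1)ᵀ * g.1 = 1 :=
    (Matrix.mem_orthogonalGroup_iff' (Fin 5) ℝ).1 (Matrix.mem_specialOrthogonalGroup_iff.1 g.2).1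
  rw [Matrix.dotProduct_mulVec, ← Matrix.mulVec_transpose, Matrix.mulVec_mulVec, h,
    Matrix.one_mulVec]

/-- The action of `SO(5)` on `V^{5,2}`, `g · (u, v) = (g u, g v)`. -/
def rot (g : SO5) (p : Stiefel) : Stiefel :=
  ⟨act g.1 p.1, by
    simp only [act_apply, dotProduct_rot]
    exact p.2⟩

theorem act_mem_tangent (g : SO5) (p : Stiefel) (w : Amb) (hw : w ∈ tangent p) :
    act g.1 w ∈ tangent (rot g p) := by
  change _ ∧ _ ∧ _
  simp only [rot, act_apply, dotProduct_rot]
  exact hw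

/-- If `g · p = q`, the derivative `T_p V → T_q V` of the translation by `g`. -/
def dRot (g : SO5) {p q : Stiefel} (h : rot g p = q) : tangent p →ₗ[ℝ] tangent q :=
  (act g.1).restrict fun w hw => h ▸ act_mem_tangent g p w hw

/-! ### Differential forms on the Stiefel manifold -/

/-- A field of alternating `k`-forms on the tangent spaces of `V^{5,2}`. -/
abbrev Form (k : ℕ) : Type := ∀ p : Stiefel, (tangent p) [⋀^Fin k]→ₗ[ℝ] ℝ

/-- The restriction to `T_p V^{5,2}` of an alternating form on the ambient space. -/
def restrictForm {k : ℕ} (p : Stiefel) (τ : Amb [⋀^Fin k]→L[ℝ] ℝ) :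
    (tangent p) [⋀^Fin k]→ₗ[ℝ] ℝ :=
  τ.toAlternatingMap.compLinearMap (tangent p).subtype

/-- The ambient differential form `τ` is a local smooth extension of `α` around `p`: on an open
neighbourhood `U` of `p` in the ambient space, `τ` is smooth and restricts to `α` on `V ∩ U`. -/
def IsLocalExtension {k : ℕ} (α : Form k) (p : Stiefel) (τ : Amb → Amb [⋀^Fin k]→L[ℝ] ℝ) : Prop :=
  ∃ U : Set Amb, IsOpen U ∧ p.1 ∈ U ∧ ContDiffOn ℝ ∞ τ U ∧
    ∀ q : Stiefel, q.1 ∈ U → restrictForm q (τ q.1) = α q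

/-- `α` is a smooth differential form on `V^{5,2}`. -/
def IsSmooth {k : ℕ} (α : Form k) : Prop :=
  ∀ p : Stiefel, ∃ τ, IsLocalExtension α p τ

/-- `dα = β` on `V^{5,2}`: at every point, `β` is the restriction of the exterior derivative of a
local smooth extension of `α`. -/
def HasExtDeriv {k : ℕ} (α : Form k) (β : Form (k + 1)) : Prop :=
  ∀ p : Stiefel, ∃ τ, IsLocalExtension α p τ ∧ β p = restrictForm p (extDeriv τ p.1)

/-- `α` is `SO(5)`-invariant, `g^* α = α` for all `g`. -/
def IsInvariant {k : ℕ} (α : Form k) : Prop :=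
  ∀ (g : SO5) (p : Stiefel), (α (rot g p)).compLinearMap (dRot g rfl) = α p

/-! ### Linear algebra of forms -/

section LinearAlgebra

variable {W : Type*} [AddCommGroup W] [Module ℝ W]

/-- The monomial `θ^{I 0} ∧ ⋯ ∧ θ^{I (k-1)}`, which maps `(w_0, …, w_{k-1})` to
`det (θ^{I j} (w_i))`. -/
def mono {n k : ℕ} (θ : Fin n → W →ₗ[ℝ] ℝ) (I : Fin k → Fin n) : W [⋀^Fin k]→ₗ[ℝ] ℝ :=
  (Matrix.detRowAlternating (R := ℝ) (n := Fin k)).compLinearMap (LinearMap.pi fun j => θ (I j))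

/-- The wedge product of real-valued alternating forms, indexed by a disjoint union. -/
def wedge {k l : ℕ} (α : W [⋀^Fin k]→ₗ[ℝ] ℝ) (β : W [⋀^Fin l]→ₗ[ℝ] ℝ) :
    W [⋀^Fin k ⊕ Fin l]→ₗ[ℝ] ℝ :=
  (LinearMap.mul' ℝ ℝ).compAlternatingMap (α.domCoprod β)

/-- The model `3`-form `f^{125} + f^{136} + f^{147} + f^{234} - f^{267} + f^{357} - f^{456}` of a
basis `f_1, …, f_7` with dual basis `f^1, …, f^7`. Lean counts the basis from `0`, so that all
indices are one less. -/
def g2Model (f : Module.Basis (Fin 7) ℝ W) : W [⋀^Fin 3]→ₗ[ℝ] ℝ :=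
  mono f.coord ![0, 1, 4] + mono f.coord ![0, 2, 5] + mono f.coord ![0, 3, 6]
    + mono f.coord ![1, 2, 3] - mono f.coord ![1, 5, 6] + mono f.coord ![2, 4, 6]
    - mono f.coord ![3, 4, 5]

/-- The Hodge dual of a `3`-form `α` on an oriented Euclidean `7`-space with orthonormal basis `f`
and volume form `ν`:
`(⋆α)(w) = (1/3!) ∑_{i,j,k} α(f_i, f_j, f_k) ν(f_i, f_j, f_k, w_0, w_1, w_2, w_3)`. -/
def hodgeStar (f : Module.Basis (Fin 7) ℝ W) (ν : W [⋀^Fin 7]→ₗ[ℝ] ℝ) (α : W [⋀^Fin 3]→ₗ[ℝ] ℝ) :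
    W [⋀^Fin 4]→ₗ[ℝ] ℝ :=
  (1 / 6 : ℝ) • ∑ i : Fin 7, ∑ j : Fin 7, ∑ k : Fin 7,
    α ![f i, f j, f k] • ((ν.curryLeft (f i)).curryLeft (f j)).curryLeft (f k)

end LinearAlgebra

/-! ### `G₂`-structures -/

/-- A `G₂`-structure on `V^{5,2}`: a smooth `3`-form that has the model shape in some basis of each
tangent space. -/
def IsG2Structure (φ : Form 3) : Prop :=
  IsSmooth φ ∧ ∀ p : Stiefel, ∃ f : Module.Basis (Fin 7) ℝ (tangent p), φ p = g2Model f

/-- `ψ = ⋆φ` for the metric and the orientation induced by the `G₂`-structure `φ`. The metric is the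
one for which the adapted bases `f` are orthonormal. The orientation is the one for which
`(u ⌟ φ) ∧ (u ⌟ φ) ∧ φ` is positive for all `u ≠ 0`; since
`(f_1 ⌟ φ) ∧ (f_1 ⌟ φ) ∧ φ = f^1 ∧ (f^{25} + f^{36} + f^{47})^3 = -6 f^{1234567}`,
the volume form is `-f^{1234567}`. -/
def IsDual (φ : Form 3) (ψ : Form 4) : Prop :=
  ∀ p : Stiefel, ∃ f : Module.Basis (Fin 7) ℝ (tangent p),
    φ p = g2Model f ∧ ψ p = hodgeStar f (-f.det) (φ p)

/-- A coclosed `G₂`-structure: `dψ = 0`, where `ψ = ⋆φ`. -/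
def IsCoclosed (φ : Form 3) : Prop :=
  IsG2Structure φ ∧ ∃ ψ : Form 4, IsDual φ ψ ∧ HasExtDeriv ψ 0

/-- A purely coclosed `G₂`-structure: coclosed with `dφ ∧ φ = 0`. -/
def IsPurelyCoclosed (φ : Form 3) : Prop :=
  IsCoclosed φ ∧ ∃ β : Form 4, HasExtDeriv φ β ∧ ∀ p : Stiefel, wedge (β p) (φ p) = 0

/-- A nearly parallel `G₂`-structure: coclosed with `dφ = 4 ψ`, where `ψ = ⋆φ`. -/
def IsNearlyParallel (φ : Form 3) : Prop :=
  IsCoclosed φ ∧ ∃ ψ : Form 4, IsDual φ ψ ∧ HasExtDeriv φ ((4 : ℝ) • ψ)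

/-! ### The base point and the reductive complement `𝔪` -/

/-- The base point: the first two vectors of the standard basis of `ℝ⁵`. Its stabiliser is `SO(3)`,
acting on the last three coordinates. -/
def base : Stiefel :=
  ⟨(Pi.single 0 1, Pi.single 1 1), by simp⟩

/-- The elementary skew-symmetric matrix `E_{ij} - E_{ji}` (rows and columns counted from `0`). -/
def skew (i j : Fin 5) : Matrix (Fin 5) (Fin 5) ℝ :=
  Matrix.single i j 1 - Matrix.single j i 1

/-- The basis `e_1, …, e_7` of the complement `𝔪` of `𝔰𝔬(3)` in `𝔰𝔬(5)`:
`E₁₂ - E₂₁`, `E₁₃ - E₃₁`, `E₁₄ - E₄₁`, `E₁₅ - E₅₁`, `E₂₃ - E₃₂`, `E₂₄ - E₄₂`, `E₂₅ - E₅₂`. -/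
def mBasis : Fin 7 → Matrix (Fin 5) (Fin 5) ℝ :=
  ![skew 0 1, skew 0 2, skew 0 3, skew 0 4, skew 1 2, skew 1 3, skew 1 4]

theorem mem_tangent_base {w : Amb} :
    w ∈ tangent base ↔ w.1 0 = 0 ∧ w.2 1 = 0 ∧ w.2 0 + w.1 1 = 0 := by
  change _ ∧ _ ∧ _ ↔ _
  simp [base]

/-- Coordinates on the tangent space at the base point. -/
def baseEquiv : tangent base ≃ₗ[ℝ] (Fin 7 → ℝ) where
  toFun w := ![w.1.2 0, -w.1.1 2, -w.1.1 3, -w.1.1 4, -w.1.2 2, -w.1.2 3, -w.1.2 4]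
  map_add' w w' := by
    ext i
    fin_cases i <;> simp <;> ring
  map_smul' c w := by
    ext i
    fin_cases i <;> simp
  invFun c := ⟨(![0, -c 0, -c 1, -c 2, -c 3], ![c 0, 0, -c 4, -c 5, -c 6]), by
    rw [mem_tangent_base]
    simp⟩
  left_inv w := by
    obtain ⟨⟨u, v⟩, hw⟩ := w
    obtain ⟨h1, h2, h3⟩ := mem_tangent_base.1 hw
    simp only at h1 h2 h3
    apply Subtype.ext
    refine Prod.ext ?_ ?_
    · ext i
      fin_cases i <;> simp [h1]
      linarith
    · ext i
      fin_cases i <;> simp [h2]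
  right_inv c := by
    ext i
    fin_cases i <;> simp

/-- The basis of the tangent space at the base point `o` that corresponds to `e_1, …, e_7` under
`𝔪 ≃ T_o V`, `A ↦ A · o`. -/
def baseFrame : Module.Basis (Fin 7) ℝ (tangent base) := Module.Basis.ofEquivFun baseEquiv

theorem baseEquiv_symm_apply (c : Fin 7 → ℝ) : (baseEquiv.symm c : Amb) =
    (![0, -c 0, -c 1, -c 2, -c 3], ![c 0, 0, -c 4, -c 5, -c 6]) := rfl

theorem baseFrame_apply (i : Fin 7) : (baseFrame i : Amb) = act (mBasis i) base.1 := by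
  simp only [baseFrame, Module.Basis.coe_ofEquivFun, act_apply, baseEquiv_symm_apply]
  refine Prod.ext ?_ ?_
  · ext j
    fin_cases i <;> fin_cases j <;> simp [mBasis, skew, base]
  · ext j
    fin_cases i <;> fin_cases j <;> simp [mBasis, skew, base]

/-! ### Invariant extension of a form at the base point -/

/-- The action of `SO(5)` on `V^{5,2}` is transitive. -/
theorem exists_rot_eq_base (p : Stiefel) : ∃ g : SO5, rot g p = base := by
  obtain ⟨⟨u, v⟩, hu, hv, huv⟩ := p
  simp only at hu hv huv
  let f : Fin 5 → EuclideanSpace ℝ (Fin 5) := ![WithLp.toLp 2 u, WithLp.toLp 2 v, 0, 0, 0]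
  have hvu : v ⬝ᵥ u = 0 := by rw [dotProduct_comm, huv]
  have hf : Orthonormal ℝ (({0, 1} : Set (Fin 5)).domRestrict f) := by
    rw [orthonormal_iff_ite]
    rintro ⟨i, hi⟩ ⟨j, hj⟩
    rw [EuclideanSpace.inner_eq_star_dotProduct]
    rcases hi with rfl | rfl <;> rcases hj with rfl | rfl <;>
      simp [f, Set.domRestrict, Subtype.ext_iff, hu, hv, huv, hvu]
  obtain ⟨b, hb⟩ := hf.exists_orthonormalBasis_extension_of_card_eq (by simp)
  have hb0 : b 0 = WithLp.toLp 2 u := hb 0 (by simp)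
  have hb1 : b 1 = WithLp.toLp 2 v := hb 1 (by simp)
  let M : Matrix (Fin 5) (Fin 5) ℝ := Matrix.of fun i j => b i j
  have hM : M * Mᵀ = 1 := by
    ext i j
    have h := orthonormal_iff_ite.1 b.orthonormal j i
    rw [EuclideanSpace.inner_eq_star_dotProduct] at h
    rw [Matrix.one_apply, Matrix.mul_apply]
    simpa [M, dotProduct, eq_comm] using h
  have hrow : ∀ i j, M i ⬝ᵥ M j = if i = j then 1 else 0 := by
    intro i j
    have h := congrFun (congrFun hM i) j
    rwa [Matrix.one_apply] at h
  have hMu : M 0 = u := by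
    ext j
    simp [M, hb0]
  have hMv : M 1 = v := by
    ext j
    simp [M, hb1]
  have hdet : M.det * M.det = 1 := by
    have h := congrArg Matrix.det hM
    rwa [Matrix.det_mul, Matrix.det_transpose, Matrix.det_one] at h
  -- correct the determinant by rescaling the last row
  let N : Matrix (Fin 5) (Fin 5) ℝ := Matrix.diagonal ![1, 1, 1, 1, M.det] * M
  have hN : N * Nᵀ = 1 := by
    have h : N * Nᵀ = Matrix.diagonal ![1, 1, 1, 1, M.det] * (M * Mᵀ) *
        Matrix.diagonal ![1, 1, 1, 1, M.det] := by
      simp only [N, Matrix.transpose_mul, Matrix.diagonal_transpose, Matrix.mul_assoc]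
    rw [h, hM, Matrix.mul_one, Matrix.diagonal_mul_diagonal, ← Matrix.diagonal_one]
    congr 1
    ext i
    fin_cases i <;> simp [hdet]
  have hNdet : N.det = 1 := by
    simp [N, Matrix.det_mul, Fin.prod_univ_five, hdet]
  have key : ∀ w, (∀ i, i ≠ 0 → i ≠ 1 → M i ⬝ᵥ w = 0) →
      N *ᵥ w = ![M 0 ⬝ᵥ w, M 1 ⬝ᵥ w, 0, 0, 0] := by
    intro w hw
    ext i
    have h : (N *ᵥ w) i = (![1, 1, 1, 1, M.det] : Fin 5 → ℝ) i * (M i ⬝ᵥ w) := by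
      simp only [N, ← Matrix.mulVec_mulVec, Matrix.mulVec_diagonal]
      rfl
    rw [h]
    fin_cases i
    · simp
    · simp
    · simp [hw 2 (by decide) (by decide)]
    · simp [hw 3 (by decide) (by decide)]
    · simp [hw 4 (by decide) (by decide)]
  refine ⟨⟨N, Matrix.mem_specialOrthogonalGroup_iff.2
    ⟨(Matrix.mem_orthogonalGroup_iff (Fin 5) ℝ).2 hN, hNdet⟩⟩, Subtype.ext ?_⟩
  change (N *ᵥ u, N *ᵥ v) = (Pi.single 0 1, Pi.single 1 1)
  refine Prod.ext ?_ ?_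
  · change N *ᵥ u = Pi.single 0 1
    rw [key u fun i h0 h1 => by rw [← hMu, hrow, if_neg h0], hMu, hMv, hu, hvu]
    ext i
    fin_cases i <;> simp
  · change N *ᵥ v = Pi.single 1 1
    rw [key v fun i h0 h1 => by rw [← hMv, hrow, if_neg h1], hMu, hMv, hv, huv]
    ext i
    fin_cases i <;> simp

/-- The `SO(5)`-invariant form on `V^{5,2}` whose value at the base point is the
`SO(3)`-invariant form `α`: at `p` it is the pull-back of `α` under the translation by a rotation
that maps `p` to the base point. -/
def invariantForm {k : ℕ} (α : (tangent base) [⋀^Fin k]→ₗ[ℝ] ℝ) : Form k :=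
  fun p => α.compLinearMap (dRot (exists_rot_eq_base p).choose (exists_rot_eq_base p).choose_spec)

/-! ### The family of invariant `3`-forms -/

/-- The coefficient `y_2`. -/
def y2 (a b x y : ℝ) : ℝ := (b ^ 2 + a * x) ^ (2 / 3 : ℝ) / (a ^ 2 + b * y) ^ (1 / 3 : ℝ)

/-- The coefficient `y_3`. -/
def y3 (a b x y : ℝ) : ℝ := (a ^ 2 + b * y) ^ (2 / 3 : ℝ) / (b ^ 2 + a * x) ^ (1 / 3 : ℝ)

/-- The orthonormal coframe `X^1 = (z / √(y₂ y₃)) e^1`, `X^i = √y₂ e^i` for `i = 2, 3, 4` and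
`X^i = √y₃ e^i` for `i = 5, 6, 7`, at the base point. -/
def coframe (a b x y z : ℝ) : Fin 7 → (tangent base) →ₗ[ℝ] ℝ := fun i =>
  (![z / √(y2 a b x y * y3 a b x y),
      √(y2 a b x y), √(y2 a b x y), √(y2 a b x y),
      √(y3 a b x y), √(y3 a b x y), √(y3 a b x y)] : Fin 7 → ℝ) i • baseFrame.coord i

/-- The `3`-form
`-X^1 ∧ (X^{25} + X^{36} + X^{47}) + p₁ X^{234} + p₂ (-X^{267} + X^{357} - X^{456})`
`  + p₃ (X^{237} - X^{246} + X^{345}) - p₄ X^{567}`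
at the base point; Lean counts from `0`, so that all indices are one less. -/
def phiBase (a b x y z : ℝ) : (tangent base) [⋀^Fin 3]→ₗ[ℝ] ℝ :=
  let X := coframe a b x y z
  let P := a ^ 2 + b * y
  let Q := b ^ 2 + a * x
  let p₁ := x * √P / Q
  let p₂ := a / √P
  let p₃ := b / √Q
  let p₄ := y * √Q / P;
  (-(mono X ![0, 1, 4] + mono X ![0, 2, 5] + mono X ![0, 3, 6]))
    + p₁ • mono X ![1, 2, 3]
    + p₂ • (-mono X ![1, 5, 6] + mono X ![2, 4, 6] - mono X ![3, 4, 5])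
    + p₃ • (mono X ![1, 2, 6] - mono X ![1, 3, 5] + mono X ![2, 3, 4])
    - p₄ • mono X ![4, 5, 6]

/-- The invariant `3`-form on `V^{5,2}` with parameters `(a, b, x, y, z)`. -/
def phi (a b x y z : ℝ) : Form 3 := invariantForm (phiBase a b x y z)

end StiefelG2

end

/-! Under the stabiliser SO(3), the tangent space at o is ℝ ⊕ (ℝ³ ⊗ ℝ²): the line of e_1 and two
copies of ℝ³. Put ω = e^{25} + e^{36} + e^{47}. The invariant 3-forms are q_0 e^1∧ω + C, where C is
the determinant of ℝ³ tensored with a binary cubic q_1 s³ + 3q_2 s²t + 3q_3 st² + q_4 t³ on ℝ²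
(`exists_form3_of_isInvariant`); the 4-forms that occur are q_0 ω²/2 + e^1∧C. An invariant form is
governed by its value at o, where d is computed from brackets in 𝔰𝔬(5) (`extDeriv_baseFrame`): de^1
= ω, and dC = e^1∧C', where C' is the derivative of the cubic along s∂_t − t∂_s. It follows that all
these 4-forms are closed (`extDeriv_form4`), so that coclosedness comes for free.

Existence: in the coframe e^i the form has coefficients (−z, x, b, −a, −y). In the coframe X, the
condition xy = ab makes the cubic the real part of a unit complex number times (s + it)³, and a
rotation of ℝ² through a third of the phase turns it into the model cubic s³ − 3st²
(`exists_adapted_basis`).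

Obstruction: dφ∧φ is a multiple of −q_0² + tr H, where H is the Hessian of the cubic. Nondegeneracy
of a G₂-form forces H to be definite (`hessian_ne_zero`), and a definite Hessian of a binary cubic
is negative definite (`hessian_trace_neg`). Hence dφ∧φ ≠ 0.

The nearly parallel case and the injectivity on the circle are comparisons of coefficients. -/

noncomputable section

namespace StiefelG2

/-! ### SO(3)-invariant polynomials on ℝ ⊕ (ℝ³ ⊗ ℝ²) -/

section InvariantPolynomials
variable {R : Type*} [CommRing R]

/-- The symplectic pairing `∑ (u_i v_{i+3} - u_{i+3} v_i)`. -/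
def om (u v : Fin 7 → R) : R :=
  u 1 * v 4 - u 4 * v 1 + (u 2 * v 5 - u 5 * v 2) + (u 3 * v 6 - u 6 * v 3)

/-- The determinant of three vectors given by coordinates. -/
def det3 (a₁ a₂ a₃ b₁ b₂ b₃ c₁ c₂ c₃ : R) : R :=
  a₁ * (b₂ * c₃ - b₃ * c₂) - a₂ * (b₁ * c₃ - b₃ * c₁) + a₃ * (b₁ * c₂ - b₂ * c₁)

/-- The cubic forms: `tri m` is the part of `det (s u' + t u'')` of degree `m` in `t`, polarised. -/
def tri (m : Fin 4) (u v w : Fin 7 → R) : R :=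
  ![det3 (u 1) (u 2) (u 3) (v 1) (v 2) (v 3) (w 1) (w 2) (w 3),
    det3 (u 4) (u 5) (u 6) (v 1) (v 2) (v 3) (w 1) (w 2) (w 3)
      + det3 (u 1) (u 2) (u 3) (v 4) (v 5) (v 6) (w 1) (w 2) (w 3)
      + det3 (u 1) (u 2) (u 3) (v 1) (v 2) (v 3) (w 4) (w 5) (w 6),
    det3 (u 1) (u 2) (u 3) (v 4) (v 5) (v 6) (w 4) (w 5) (w 6)
      + det3 (u 4) (u 5) (u 6) (v 1) (v 2) (v 3) (w 4) (w 5) (w 6)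
      + det3 (u 4) (u 5) (u 6) (v 4) (v 5) (v 6) (w 1) (w 2) (w 3),
    det3 (u 4) (u 5) (u 6) (v 4) (v 5) (v 6) (w 4) (w 5) (w 6)] m

/-- The binary cubic with coefficients `q 1, …, q 4`, polarised. -/
def cubic (q : Fin 5 → R) (u v w : Fin 7 → R) : R :=
  q 1 * tri 0 u v w + q 2 * tri 1 u v w + q 3 * tri 2 u v w + q 4 * tri 3 u v w

/-- The invariant `3`-form with coefficients `q`, in coordinates. -/
def inv3 (q : Fin 5 → R) (u v w : Fin 7 → R) : R :=
  q 0 * (u 0 * om v w - v 0 * om u w + w 0 * om u v) + cubic q u v w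

/-- The invariant `4`-form with coefficients `q`, in coordinates. -/
def inv4 (q : Fin 5 → R) (u v w x : Fin 7 → R) : R :=
  q 0 * (om u v * om w x - om u w * om v x + om u x * om v w)
    + (u 0 * cubic q v w x - v 0 * cubic q u w x + w 0 * cubic q u v x - x 0 * cubic q u v w)

end InvariantPolynomials

/-! ### Invariant 3- and 4-forms as sums of monomials -/

section Forms
variable {W : Type*} [AddCommGroup W] [Module ℝ W]

/-- The multi-indices of the monomials of invariant `3`-forms. -/
def index3 : Fin 11 → Fin 3 → Fin 7 :=
  ![![0, 1, 4], ![0, 2, 5], ![0, 3, 6], ![1, 2, 3], ![1, 2, 6], ![1, 3, 5], ![2, 3, 4],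
    ![1, 5, 6], ![2, 4, 6], ![3, 4, 5], ![4, 5, 6]]

/-- The signs of the monomials of invariant `3`-forms. -/
def sign3 : Fin 11 → ℤ := ![1, 1, 1, 1, 1, -1, 1, 1, -1, 1, 1]

/-- The multi-indices of the monomials of invariant `4`-forms. -/
def index4 : Fin 11 → Fin 4 → Fin 7 :=
  ![![1, 4, 2, 5], ![1, 4, 3, 6], ![2, 5, 3, 6], ![0, 1, 2, 3], ![0, 1, 2, 6], ![0, 1, 3, 5],
    ![0, 2, 3, 4], ![0, 1, 5, 6], ![0, 2, 4, 6], ![0, 3, 4, 5], ![0, 4, 5, 6]]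

/-- The basic invariant form to which a monomial contributes. -/
def kind : Fin 11 → Fin 5 := ![0, 0, 0, 1, 2, 2, 2, 3, 3, 3, 4]

/-- The invariant `3`-form with coefficients `q` in the coframe `θ`. -/
def form3 (θ : Fin 7 → W →ₗ[ℝ] ℝ) (q : Fin 5 → ℝ) : W [⋀^Fin 3]→ₗ[ℝ] ℝ :=
  ∑ n, (q (kind n) * sign3 n) • mono θ (index3 n)

/-- The invariant `4`-form with coefficients `q` in the coframe `θ`. -/
def form4 (θ : Fin 7 → W →ₗ[ℝ] ℝ) (q : Fin 5 → ℝ) : W [⋀^Fin 4]→ₗ[ℝ] ℝ :=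
  ∑ n, (q (kind n) * sign3 n) • mono θ (index4 n)

theorem mono_apply {n k : ℕ} (θ : Fin n → W →ₗ[ℝ] ℝ) (I : Fin k → Fin n) (w : Fin k → W) :
    mono θ I w = Matrix.det (Matrix.of fun i j => θ (I j) (w i)) := rfl

theorem form3_apply (θ : Fin 7 → W →ₗ[ℝ] ℝ) (q : Fin 5 → ℝ) (w : Fin 3 → W) :
    form3 θ q w = inv3 q (θ · (w 0)) (θ · (w 1)) (θ · (w 2)) := by
  simp [form3, Fin.sum_univ_succ, mono_apply, Matrix.det_fin_three, kind, sign3, index3, inv3,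
    cubic, tri, det3, om]
  ring

theorem mono_four_apply {n : ℕ} (θ : Fin n → W →ₗ[ℝ] ℝ) (I : Fin 4 → Fin n) (w : Fin 4 → W) :
    mono θ I w =
      θ (I 0) (w 0) * det3 (θ (I 1) (w 1)) (θ (I 2) (w 1)) (θ (I 3) (w 1))
        (θ (I 1) (w 2)) (θ (I 2) (w 2)) (θ (I 3) (w 2))
        (θ (I 1) (w 3)) (θ (I 2) (w 3)) (θ (I 3) (w 3))
      - θ (I 0) (w 1) * det3 (θ (I 1) (w 0)) (θ (I 2) (w 0)) (θ (I 3) (w 0))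
        (θ (I 1) (w 2)) (θ (I 2) (w 2)) (θ (I 3) (w 2))
        (θ (I 1) (w 3)) (θ (I 2) (w 3)) (θ (I 3) (w 3))
      + θ (I 0) (w 2) * det3 (θ (I 1) (w 0)) (θ (I 2) (w 0)) (θ (I 3) (w 0))
        (θ (I 1) (w 1)) (θ (I 2) (w 1)) (θ (I 3) (w 1))
        (θ (I 1) (w 3)) (θ (I 2) (w 3)) (θ (I 3) (w 3))
      - θ (I 0) (w 3) * det3 (θ (I 1) (w 0)) (θ (I 2) (w 0)) (θ (I 3) (w 0))
        (θ (I 1) (w 1)) (θ (I 2) (w 1)) (θ (I 3) (w 1))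
        (θ (I 1) (w 2)) (θ (I 2) (w 2)) (θ (I 3) (w 2)) := by
  rw [mono_apply, Matrix.det_succ_column_zero]
  simp only [Fin.sum_univ_four, Matrix.det_fin_three, Matrix.submatrix_apply, Matrix.of_apply]
  simp [Fin.succAbove, det3, Fin.lt_def]
  simp only [← Fin.succ_zero_eq_one, ← Fin.succ_one_eq_two]
  ring

theorem form4_apply (θ : Fin 7 → W →ₗ[ℝ] ℝ) (q : Fin 5 → ℝ) (w : Fin 4 → W) :
    form4 θ q w = inv4 q (θ · (w 0)) (θ · (w 1)) (θ · (w 2)) (θ · (w 3)) := by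
  simp only [form4, Fin.sum_univ_succ, AlternatingMap.add_apply, AlternatingMap.smul_apply,
    Finset.univ_eq_empty, Finset.sum_empty, AlternatingMap.zero_apply, mono_four_apply]
  simp [kind, sign3, index4, inv4, cubic, tri, det3, om]
  ring

end Forms

/-! ### Integral values of the invariant forms on basis vectors -/

section Tables

/-- The coordinates of the basis vectors. -/
def unitVec (i k : Fin 7) : ℤ := if i = k then 1 else 0

/-- The class modulo `3` of a basis vector with positive index. -/
def cls : Fin 7 → ℤ := ![0, 0, 1, 2, 0, 1, 2]

/-- `0` for the basis vectors of the first triple, `1` for those of the second. -/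
def typ : Fin 7 → ℤ := ![0, 0, 0, 0, 1, 1, 1]

/-- The values of `om` on basis vectors. -/
def omTable (i j : Fin 7) : ℤ :=
  if i = 0 ∨ j = 0 ∨ cls i ≠ cls j then 0 else typ j - typ i

/-- The values of the cubics on basis vectors. -/
def triTable (m : Fin 5) (i j k : Fin 7) : ℤ :=
  if i = 0 ∨ j = 0 ∨ k = 0 ∨ typ i + typ j + typ k + 1 ≠ m then 0
  else (cls i - cls j) * (cls j - cls k) * (cls k - cls i) / 2

/-- The values of the basic invariant `3`-forms on basis vectors. -/
def table3 (m : Fin 5) (v : Fin 3 → Fin 7) : ℤ :=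
  if m = 0 then
    unitVec (v 0) 0 * omTable (v 1) (v 2) - unitVec (v 1) 0 * omTable (v 0) (v 2)
      + unitVec (v 2) 0 * omTable (v 0) (v 1)
  else triTable m (v 0) (v 1) (v 2)

/-- The values of the basic invariant `4`-forms on basis vectors. -/
def table4 (m : Fin 5) (v : Fin 4 → Fin 7) : ℤ :=
  if m = 0 then
    omTable (v 0) (v 1) * omTable (v 2) (v 3) - omTable (v 0) (v 2) * omTable (v 1) (v 3)
      + omTable (v 0) (v 3) * omTable (v 1) (v 2)
  else
    unitVec (v 0) 0 * triTable m (v 1) (v 2) (v 3) - unitVec (v 1) 0 * triTable m (v 0) (v 2) (v 3)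
      + unitVec (v 2) 0 * triTable m (v 0) (v 1) (v 3)
      - unitVec (v 3) 0 * triTable m (v 0) (v 1) (v 2)

theorem om_unitVec : ∀ i j, om (unitVec i) (unitVec j) = omTable i j := by decide +kernel

/-- The halved Vandermonde product of the classes in `triTable` is the sign of a permutation of the
three classes. The shift by one arises because entry `0` of a coefficient vector is reserved for the
form built from ω. -/
theorem tri_unitVec : ∀ (m : Fin 4) (i j k : Fin 7),
    tri m (unitVec i) (unitVec j) (unitVec k) = triTable m.succ i j k := by decide +kernel

/-- The sign of a tuple as a permutation, `0` if there is a repetition. -/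
def tupleSign {n : ℕ} (v : Fin n → Fin n) : ℤ :=
  ∏ j, ∏ i ∈ Finset.Iio j, if v i < v j then 1 else if v i = v j then 0 else -1

theorem tupleSign_perm {n : ℕ} (σ : Equiv.Perm (Fin n)) : tupleSign σ = Equiv.Perm.sign σ := by
  rw [Equiv.Perm.sign_eq_prod_prod_Iio, tupleSign]
  push_cast
  refine Finset.prod_congr rfl fun j _ => Finset.prod_congr rfl fun i hi => ?_
  have : i ≠ j := (Finset.mem_Iio.1 hi).ne
  simp only [EmbeddingLike.apply_eq_iff_eq, this, if_false]
  split_ifs <;> simp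

theorem tupleSign_of_not_injective {n : ℕ} {v : Fin n → Fin n} (hv : ¬ v.Injective) :
    tupleSign v = 0 := by
  obtain ⟨i, j, h, hij⟩ : ∃ i j, v i = v j ∧ i < j := by
    simp only [Function.Injective, not_forall] at hv
    obtain ⟨i, j, h, hij⟩ := hv
    rcases lt_or_gt_of_ne hij with h' | h'
    exacts [⟨i, j, h, h'⟩, ⟨j, i, h.symm, h'⟩]
  refine Finset.prod_eq_zero (Finset.mem_univ j) (Finset.prod_eq_zero (Finset.mem_Iio.2 hij) ?_)
  simp [h]

end Tables

/-! ### Evaluation on a basis and the Hodge dual of the model form -/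

section Basis
variable {W : Type*} [AddCommGroup W] [Module ℝ W]

theorem alternating_sum_apply {ι κ : Type*} (s : Finset ι) (A : ι → W [⋀^κ]→ₗ[ℝ] ℝ)
    (w : κ → W) : (∑ i ∈ s, A i) w = ∑ i ∈ s, A i w :=
  map_sum ({ toFun := fun α => α w, map_zero' := rfl, map_add' := fun _ _ => rfl } :
    (W [⋀^κ]→ₗ[ℝ] ℝ) →+ ℝ) A s

theorem om_cast (u v : Fin 7 → ℤ) :
    om (fun k => (u k : ℝ)) (fun k => (v k : ℝ)) = (om u v : ℤ) := by
  simp [om]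

theorem tri_cast (m : Fin 4) (u v w : Fin 7 → ℤ) :
    tri m (fun k => (u k : ℝ)) (fun k => (v k : ℝ)) (fun k => (w k : ℝ)) = (tri m u v w : ℤ) := by
  fin_cases m <;> simp [tri, det3]

theorem coord_basis (f : Module.Basis (Fin 7) ℝ W) (i : Fin 7) :
    (fun k => f.coord k (f i)) = fun k => (unitVec i k : ℝ) := by
  ext k
  simp [unitVec, Finsupp.single_apply]

theorem form3_basis (f : Module.Basis (Fin 7) ℝ W) (q : Fin 5 → ℝ) (v : Fin 3 → Fin 7) :
    form3 f.coord q (f ∘ v) = ∑ m, q m * (table3 m v : ℝ) := by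
  rw [form3_apply]
  simp only [Function.comp_apply, coord_basis, inv3, cubic, om_cast, tri_cast, om_unitVec,
    tri_unitVec]
  simp only [fun i => congrFun (coord_basis f i) 0]
  simp only [Fin.sum_univ_five, table3]
  simp
  ring

theorem form4_basis (f : Module.Basis (Fin 7) ℝ W) (q : Fin 5 → ℝ) (v : Fin 4 → Fin 7) :
    form4 f.coord q (f ∘ v) = ∑ m, q m * (table4 m v : ℝ) := by
  rw [form4_apply]
  simp only [Function.comp_apply, coord_basis, inv4, cubic, om_cast, tri_cast, om_unitVec,
    tri_unitVec]
  simp only [fun i => congrFun (coord_basis f i) 0]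
  simp only [Fin.sum_univ_five, table4]
  simp
  ring

/-- Alternating forms that agree on increasing tuples of basis vectors are equal. -/
theorem ext_strictMono {n k : ℕ} (f : Module.Basis (Fin n) ℝ W) {α β : W [⋀^Fin k]→ₗ[ℝ] ℝ}
    (h : ∀ v : Fin k → Fin n, StrictMono v → α (f ∘ v) = β (f ∘ v)) : α = β := by
  refine Module.Basis.ext_alternating f fun v hv => ?_
  have hs : StrictMono (v ∘ Tuple.sort v) :=
    (Tuple.monotone_sort v).strictMono_of_injective (hv.comp (Equiv.injective _))
  have h' := h _ hs
  rw [← Function.comp_assoc, AlternatingMap.map_perm, AlternatingMap.map_perm] at h'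
  exact smul_left_cancel _ h'

theorem det_basis_comp {n : ℕ} (f : Module.Basis (Fin n) ℝ W) (v : Fin n → Fin n) :
    f.det (f ∘ v) = tupleSign v := by
  by_cases hv : v.Injective
  · have h := AlternatingMap.map_perm f.det f (Equiv.ofBijective v (Finite.injective_iff_bijective.1 hv))
    rw [f.det_self] at h
    have h2 := tupleSign_perm (Equiv.ofBijective v (Finite.injective_iff_bijective.1 hv))
    simp only [Equiv.coe_ofBijective] at h h2
    rw [h, h2]
    simp [Units.smul_def]
  · rw [tupleSign_of_not_injective hv, AlternatingMap.map_eq_zero_of_not_injective]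
    · simp
    · exact fun h => hv h.of_comp

theorem g2Model_eq_form3 (f : Module.Basis (Fin 7) ℝ W) :
    g2Model f = form3 f.coord ![1, 1, 0, -1, 0] := by
  simp [g2Model, form3, Fin.sum_univ_succ, kind, index3, sign3]
  module

/-- The finite computation behind `hodgeStar_g2Model`. The vanishing values of the model form are
split off so that `tupleSign` has to be evaluated only where it contributes. -/
theorem hodge_table : ∀ i j k l : Fin 7, i < j → j < k → k < l →
    ∑ a : Fin 7, ∑ b : Fin 7, ∑ c : Fin 7,
      (if table3 0 ![a, b, c] + table3 1 ![a, b, c] - table3 3 ![a, b, c] = 0 then 0 else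
      (table3 0 ![a, b, c] + table3 1 ![a, b, c] - table3 3 ![a, b, c]) *
        - tupleSign ![a, b, c, i, j, k, l]) =
      6 * (table4 0 ![i, j, k, l] - table4 2 ![i, j, k, l] + table4 4 ![i, j, k, l]) := by
  decide +kernel

theorem forall_strictMono {k : ℕ} {P : (Fin 4 → Fin k) → Prop}
    (h : ∀ i j k l, i < j → j < k → k < l → P ![i, j, k, l]) (v : Fin 4 → Fin k)
    (hv : StrictMono v) : P v := by
  have h' := h (v 0) (v 1) (v 2) (v 3) (hv (by decide)) (hv (by decide)) (hv (by decide))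
  convert h' using 1
  ext i
  fin_cases i <;> rfl

/-- With Ω the complex form of the cubic (s + it)³, the model is f^1∧ω + Re Ω, and its dual is ω²/2
− f^1∧Im Ω. -/
theorem hodgeStar_g2Model (f : Module.Basis (Fin 7) ℝ W) :
    hodgeStar f (-f.det) (g2Model f) = form4 f.coord ![1, 0, -1, 0, 1] := by
  refine ext_strictMono f fun v hv => ?_
  revert v
  refine forall_strictMono fun i j k l hij hjk hkl => ?_
  have key : ∀ a b c : Fin 7, g2Model f ![f a, f b, f c] *
      ((((-f.det).curryLeft (f a)).curryLeft (f b)).curryLeft (f c)) (f ∘ ![i, j, k, l]) =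
      ((if table3 0 ![a, b, c] + table3 1 ![a, b, c] - table3 3 ![a, b, c] = 0 then 0 else
      (table3 0 ![a, b, c] + table3 1 ![a, b, c] - table3 3 ![a, b, c]) *
        - tupleSign ![a, b, c, i, j, k, l] : ℤ) : ℝ) := by
    intro a b c
    have h1 : (![f a, f b, f c] : Fin 3 → W) = f ∘ ![a, b, c] := by
      ext s; fin_cases s <;> rfl
    have h2 : ((((-f.det).curryLeft (f a)).curryLeft (f b)).curryLeft (f c)) (f ∘ ![i, j, k, l]) =
        - f.det (f ∘ ![a, b, c, i, j, k, l]) := by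
      simp only [AlternatingMap.curryLeft_apply_apply, AlternatingMap.neg_apply]
      congr 2
      ext s; fin_cases s <;> rfl
    rw [h1, h2, det_basis_comp, g2Model_eq_form3, form3_basis]
    simp only [Fin.sum_univ_five]
    split_ifs with h0
    · rw [← Int.cast_inj (α := ℝ)] at h0
      push_cast at h0
      simp
      left
      linarith
    · simp
      ring_nf
      simp
  have hz := hodge_table i j k l hij hjk hkl
  rw [← Int.cast_inj (α := ℝ)] at hz
  rw [form4_basis, hodgeStar, AlternatingMap.smul_apply]
  simp only [alternating_sum_apply, AlternatingMap.smul_apply, smul_eq_mul, key]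
  rw [Int.cast_sum] at hz
  simp only [Int.cast_sum] at hz
  rw [hz]
  simp [Fin.sum_univ_five]
  ring

end Basis

/-! ### The pairing of invariant 4-forms with invariant 3-forms -/

section Wedge
variable {W : Type*} [AddCommGroup W] [Module ℝ W]

open scoped TensorProduct in
theorem wedge_sum_smul {ι κ : Type*} [Fintype ι] [Fintype κ] {k l : ℕ} (a : ι → ℝ) (b : κ → ℝ)
    (A : ι → W [⋀^Fin k]→ₗ[ℝ] ℝ) (B : κ → W [⋀^Fin l]→ₗ[ℝ] ℝ) :
    wedge (∑ i, a i • A i) (∑ j, b j • B j) = ∑ i, ∑ j, (a i * b j) • wedge (A i) (B j) := by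
  let L := (LinearMap.compAlternatingMapₗ (M := W) (ι := Fin k ⊕ Fin l) ℝ (LinearMap.mul' ℝ ℝ)) ∘ₗ
    AlternatingMap.domCoprod' (ιa := Fin k) (ιb := Fin l) (R' := ℝ) (Mᵢ := W) (N₁ := ℝ) (N₂ := ℝ)
  have hL : ∀ (α : W [⋀^Fin k]→ₗ[ℝ] ℝ) (β : W [⋀^Fin l]→ₗ[ℝ] ℝ), wedge α β = L (α ⊗ₜ β) :=
    fun α β => rfl
  simp only [hL, TensorProduct.sum_tmul, TensorProduct.tmul_sum, ← TensorProduct.smul_tmul',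
    TensorProduct.tmul_smul, map_sum, map_smul, Finset.smul_sum, smul_smul]
  rw [Finset.sum_comm]
  simp only [mul_comm]

/-- Since alternatisation is compatible with products, this presentation makes the wedge of two
monomials a single determinant. -/
theorem mono_eq_alternatization {n k : ℕ} (θ : Fin n → W →ₗ[ℝ] ℝ) (I : Fin k → Fin n) :
    mono θ I = MultilinearMap.alternatization
      ((MultilinearMap.mkPiAlgebra ℝ (Fin k) ℝ).compLinearMap fun j => θ (I j)) := by
  ext w
  simp only [mono_apply, Matrix.det_apply, MultilinearMap.alternatization_apply]
  rfl

theorem wedge_mono {n k l : ℕ} (θ : Fin n → W →ₗ[ℝ] ℝ) (I : Fin k → Fin n) (J : Fin l → Fin n)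
    (w : Fin k ⊕ Fin l → W) :
    wedge (mono θ I) (mono θ J) w = Matrix.det (Matrix.of fun s t => θ (Sum.elim I J t) (w s)) := by
  rw [wedge, mono_eq_alternatization, mono_eq_alternatization,
    ← MultilinearMap.domCoprod_alternization, ← LinearMap.compMultilinearMap_alternatization,
    MultilinearMap.alternatization_apply, Matrix.det_apply]
  refine Finset.sum_congr rfl fun σ _ => ?_
  simp [Fintype.prod_sum_type]

theorem wedge_mono_basis {k l : ℕ} (f : Module.Basis (Fin (k + l)) ℝ W) (I : Fin k → Fin (k + l))
    (J : Fin l → Fin (k + l)) :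
    wedge (mono f.coord I) (mono f.coord J) (f ∘ finSumFinEquiv) = tupleSign (Fin.append I J) := by
  rw [wedge_mono, ← det_basis_comp f, Module.Basis.det_apply,
    ← Matrix.det_submatrix_equiv_self finSumFinEquiv]
  congr 1
  ext s t
  have h : ∀ t : Fin k ⊕ Fin l, Fin.append I J (finSumFinEquiv t) = Sum.elim I J t := by
    rintro (t | t) <;> simp
  simp [Module.Basis.toMatrix_apply, h, Finsupp.single_apply, eq_comm]

/-- The monomial that complements a given one. -/
def partner : Fin 11 → Fin 11 := ![2, 1, 0, 10, 9, 8, 7, 6, 5, 4, 3]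

/-- The sign of the product of a monomial with its complement. -/
def partnerSign : Fin 11 → ℤ := ![-1, -1, -1, 1, -1, -1, -1, 1, 1, 1, -1]

theorem sign_append : ∀ n m, sign3 n * sign3 m * tupleSign (Fin.append (index4 n) (index3 m)) =
    if m = partner n then partnerSign n else 0 := by
  decide +kernel

theorem wedge_form4_form3 (f : Module.Basis (Fin 7) ℝ W) (p q : Fin 5 → ℝ) :
    wedge (form4 f.coord p) (form3 f.coord q) (f ∘ finSumFinEquiv (m := 4) (n := 3)) =
      -3 * p 0 * q 0 + p 1 * q 4 - 3 * p 2 * q 3 + 3 * p 3 * q 2 - p 4 * q 1 := by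
  rw [form4, form3, wedge_sum_smul]
  simp only [alternating_sum_apply, AlternatingMap.smul_apply, wedge_mono_basis (k := 4) (l := 3) f,
    smul_eq_mul]
  have h : ∀ n m, p (kind n) * (sign3 n : ℝ) * (q (kind m) * (sign3 m : ℝ)) *
      (tupleSign (Fin.append (index4 n) (index3 m)) : ℝ) =
      if m = partner n then p (kind n) * q (kind m) * (partnerSign n : ℝ) else 0 := by
    intro n m
    have h' := congrArg (Int.cast (R := ℝ)) (sign_append n m)
    push_cast at h'
    rw [← mul_ite_zero, ← h']
    ring
  simp only [h, Finset.sum_ite_eq', Finset.mem_univ, if_true]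
  simp [Fin.sum_univ_succ, kind, partner, partnerSign]
  ring

end Wedge

/-! ### The exterior derivative of an invariant form through brackets -/

section ExteriorDerivative

theorem exp_mem_specialOrthogonal {A : Matrix (Fin 5) (Fin 5) ℝ} (hA : Aᵀ = -A) :
    NormedSpace.exp A ∈ Matrix.specialOrthogonalGroup (Fin 5) ℝ := by
  have horth : ∀ B : Matrix (Fin 5) (Fin 5) ℝ, Bᵀ = -B →
      NormedSpace.exp B * (NormedSpace.exp B)ᵀ = 1 := by
    intro B hB
    rw [← Matrix.exp_transpose, hB, ← Matrix.exp_add_of_commute _ _ (Commute.refl B).neg_right,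
      add_neg_cancel, NormedSpace.exp_zero]
  -- Orthogonality only gives determinant ±1; writing exp A as the square of exp (A/2) makes the
  -- determinant a square.
  have hhalf : ((1 / 2 : ℝ) • A)ᵀ = -((1 / 2 : ℝ) • A) := by
    rw [Matrix.transpose_smul, hA, smul_neg]
  refine Matrix.mem_specialOrthogonalGroup_iff.2
    ⟨(Matrix.mem_orthogonalGroup_iff (Fin 5) ℝ).2 (horth A hA), ?_⟩
  have h := congrArg Matrix.det (horth _ hhalf)
  rw [Matrix.det_mul, Matrix.det_transpose, Matrix.det_one, ← Matrix.det_mul,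
    ← Matrix.exp_add_of_commute _ _ rfl, ← add_smul] at h
  norm_num at h
  exact h

open scoped Matrix.Norms.Operator in
theorem hasDerivAt_act_exp (A : Matrix (Fin 5) (Fin 5) ℝ) (w : Amb) :
    HasDerivAt (fun t : ℝ => act (NormedSpace.exp (t • A)) w) (act A w) 0 := by
  have h := hasDerivAt_exp_smul_const (𝕂 := ℝ) A 0
  rw [zero_smul, NormedSpace.exp_zero, one_mul] at h
  let L : Matrix (Fin 5) (Fin 5) ℝ →ₗ[ℝ] Amb :=
    { toFun := fun M => act M w
      map_add' := fun M N => by simp [act_apply, Matrix.add_mulVec]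
      map_smul' := fun c M => by simp [act_apply, Matrix.smul_mulVec] }
  exact L.toContinuousLinearMap.hasFDerivAt.comp_hasDerivAt (0 : ℝ) h

theorem act_mul (A B : Matrix (Fin 5) (Fin 5) ℝ) (w : Amb) : act (A * B) w = act A (act B w) := by
  simp [act_apply]

theorem act_add (A B : Matrix (Fin 5) (Fin 5) ℝ) (w : Amb) : act (A + B) w = act A w + act B w := by
  simp [act_apply, Matrix.add_mulVec]

theorem act_smul (c : ℝ) (A : Matrix (Fin 5) (Fin 5) ℝ) (w : Amb) :
    act (c • A) w = c • act A w := by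
  simp [act_apply, Matrix.smul_mulVec]

theorem act_one (w : Amb) : act 1 w = w := by
  simp [act_apply]

theorem IsLocalExtension.differentiableAt {k : ℕ} {α : Form k} {p : Stiefel}
    {τ : Amb → Amb [⋀^Fin k]→L[ℝ] ℝ} (h : IsLocalExtension α p τ) : DifferentiableAt ℝ τ p.1 := by
  obtain ⟨U, hU, hp, hτ, -⟩ := h
  exact (hτ.contDiffAt (hU.mem_nhds hp)).differentiableAt (by simp)

/-- The derivative of an extension of an invariant form along the action of a skew matrix. -/
theorem fderiv_act_apply {k : ℕ} {α : Form k} (hα : IsInvariant α) {p : Stiefel}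
    {τ : Amb → Amb [⋀^Fin k]→L[ℝ] ℝ} (h : IsLocalExtension α p τ)
    {A : Matrix (Fin 5) (Fin 5) ℝ} (hA : Aᵀ = -A) (w : Fin k → Amb) (hw : ∀ i, w i ∈ tangent p) :
    fderiv ℝ τ p.1 (act A p.1) w = -∑ i, τ p.1 (Function.update w i (act A (w i))) := by
  have hd := h.differentiableAt
  obtain ⟨U, hU, hp, -, hτα⟩ := h
  have hc : ∀ v : Amb, HasDerivAt (fun t : ℝ => act (NormedSpace.exp (t • A)) v) (act A v) 0 :=
    hasDerivAt_act_exp A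
  have h0 : ∀ v, act (NormedSpace.exp ((0 : ℝ) • A)) v = v := by
    intro v
    rw [zero_smul, NormedSpace.exp_zero, act_one]
  have hskew : ∀ t : ℝ, (t • A)ᵀ = -(t • A) := by
    intro t
    rw [Matrix.transpose_smul, hA, smul_neg]
  have hd' : HasFDerivAt τ (fderiv ℝ τ p.1) (act (NormedSpace.exp ((0 : ℝ) • A)) p.1) := by
    rw [h0]
    exact hd.hasFDerivAt
  have hτ := (hd'.comp_hasDerivAt (0 : ℝ) (hc p.1)).hasFDerivAt
  have key := hτ.continuousAlternatingMap_apply (fun i => (hc (w i)).hasFDerivAt)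
  -- By invariance the form is constant along the flow of A while the flow stays in the domain of
  -- the extension. Differentiating at 0 gives the formula.
  have hconst : (fun t : ℝ => (τ ∘ fun t : ℝ => act (NormedSpace.exp (t • A)) p.1) t
      (fun i => act (NormedSpace.exp (t • A)) (w i))) =ᶠ[𝓝 0] fun _ => τ p.1 w := by
    have hmem : ∀ᶠ t : ℝ in 𝓝 0, act (NormedSpace.exp (t • A)) p.1 ∈ U :=
      (hc p.1).continuousAt.eventually_mem (by rw [h0]; exact hU.mem_nhds hp)
    filter_upwards [hmem] with t ht
    let g : SO5 := ⟨_, exp_mem_specialOrthogonal (hskew t)⟩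
    have h1 : (α (rot g p)).compLinearMap (dRot g rfl) (fun i => (⟨w i, hw i⟩ : tangent p)) =
        α p fun i => ⟨w i, hw i⟩ := by rw [hα g p]
    rw [← hτα p hp, ← hτα (rot g p) ht] at h1
    exact h1
  have hu := key.unique ((hasFDerivAt_const (τ p.1 w) (0 : ℝ)).congr_of_eventuallyEq hconst)
  have h2 := congrArg (fun L : ℝ →L[ℝ] ℝ => L 1) hu
  simp [act_one] at h2
  rw [eq_neg_iff_add_eq_zero]
  exact h2

/-- The matrix in the complement `𝔪` with given coordinates. -/
def mMatrix : (Fin 7 → ℝ) →ₗ[ℝ] Matrix (Fin 5) (Fin 5) ℝ := Fintype.linearCombination ℝ mBasis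

theorem mMatrix_single (i : Fin 7) : mMatrix (Pi.single i 1) = mBasis i := by
  simp [mMatrix]

theorem mBasis_transpose (i : Fin 7) : (mBasis i)ᵀ = -mBasis i := by
  fin_cases i <;> simp [mBasis, skew]

/-- Differentiating τ along A_i·o inserts A_i A_j·o in slot j. The factor 2 splits 2 A_i A_j into
commutator and anticommutator. The anticommutator is symmetric in i and j, hence disappears under
alternatisation. The products A_i A_j·o need not be tangent, which is harmless because τ is an
ambient form. -/
theorem extDeriv_apply_baseFrame {k : ℕ} {α : Form k} (hα : IsInvariant α)
    {τ : Amb → Amb [⋀^Fin k]→L[ℝ] ℝ} (h : IsLocalExtension α base τ) (v : Fin (k + 1) → Fin 7) :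
    2 * extDeriv τ base.1 (fun i => (baseFrame (v i) : Amb)) =
      -∑ i : Fin (k + 1), (-1) ^ (i : ℕ) * ∑ j, τ base.1 (Function.update
        (fun j => (baseFrame (i.removeNth v j) : Amb)) j
        (act (mBasis (v i) * mBasis (i.removeNth v j) - mBasis (i.removeNth v j) * mBasis (v i))
          base.1)) := by
  let g : (Fin 7 → ℝ) →ₗ[ℝ] Amb := (Fintype.linearCombination ℝ fun i => (baseFrame i : Amb))
  let b : (Fin 7 → ℝ) →ₗ[ℝ] (Fin 7 → ℝ) →ₗ[ℝ] Amb := LinearMap.mk₂ ℝ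
    (fun x y => act (mMatrix x * mMatrix y + mMatrix y * mMatrix x) base.1)
    (fun x y z => by simp only [map_add, mul_add, add_mul, act_add]; abel)
    (fun c x y => by simp only [map_smul, Algebra.mul_smul_comm, Algebra.smul_mul_assoc,
      ← smul_add, act_smul])
    (fun x y z => by simp only [map_add, mul_add, add_mul, act_add]; abel)
    (fun c x y => by simp only [map_smul, Algebra.mul_smul_comm, Algebra.smul_mul_assoc,
      ← smul_add, act_smul])
  have hb : ∀ x y, b x y = act (mMatrix x * mMatrix y + mMatrix y * mMatrix x) base.1 :=
    fun _ _ => rfl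
  -- Inserting a symmetric bilinear map in one slot and alternatising gives zero.
  have hsymm := ContinuousAlternatingMap.alternatizeUncurryFin_fderivCompContinuousLinearMap_eq_zero
    (τ base.1) g.toContinuousLinearMap (h := b.toContinuousBilinearMap)
    (fun x y => by simp only [LinearMap.toContinuousBilinearMap_apply, hb, add_comm])
  have hsymm' := congrArg (fun β => β fun i => Pi.single (v i) 1) hsymm
  simp only [ContinuousAlternatingMap.alternatizeUncurryFin_apply] at hsymm'
  have hg : ∀ i, g (Pi.single i 1) = baseFrame i := fun i => by simp [g]
  have hbs : ∀ i j, b (Pi.single i 1) (Pi.single j 1) =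
      act (mBasis i * mBasis j + mBasis j * mBasis i) base.1 := fun i j => by
    rw [hb, mMatrix_single, mMatrix_single]
  have hupd : ∀ (i : Fin (k + 1)) (j : Fin k), (fun l => (Function.update
      (fun _ : Fin k => g.toContinuousLinearMap) j (b.toContinuousBilinearMap (Pi.single (v i) 1)) l)
      (i.removeNth (fun i => (Pi.single (v i) 1 : Fin 7 → ℝ)) l)) =
      Function.update (fun j => (baseFrame (i.removeNth v j) : Amb)) j
        (act (mBasis (v i) * mBasis (i.removeNth v j) + mBasis (i.removeNth v j) * mBasis (v i))
          base.1) := by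
    intro i j
    ext1 l
    rcases eq_or_ne l j with rfl | hl
    · simp [Fin.removeNth, hbs]
    · simp [Fin.removeNth, hl, hg]
  simp only [ContinuousLinearMap.comp_apply,
    ContinuousAlternatingMap.fderivCompContinuousLinearMap_apply, hupd] at hsymm'
  rw [extDeriv, ContinuousAlternatingMap.alternatizeUncurryFin_apply]
  have hterm : ∀ i : Fin (k + 1), fderiv ℝ τ base.1 (baseFrame (v i))
      (i.removeNth fun i => (baseFrame (v i) : Amb)) = -∑ j, τ base.1 (Function.update
        (fun j => (baseFrame (i.removeNth v j) : Amb)) j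
        (act (mBasis (v i) * mBasis (i.removeNth v j)) base.1)) := by
    intro i
    have := fderiv_act_apply hα h (mBasis_transpose (v i))
      (fun j => (baseFrame (i.removeNth v j) : Amb)) (fun j => (baseFrame _).2)
    rw [← baseFrame_apply] at this
    change fderiv ℝ τ base.1 (baseFrame (v i))
      (fun j => (baseFrame (i.removeNth v j) : Amb)) = _
    rw [this]
    simp only [act_mul, baseFrame_apply]
  have hsub : ∀ (A B : Matrix (Fin 5) (Fin 5) ℝ) (w : Fin k → Amb) (j : Fin k),
      τ base.1 (Function.update w j (act (A - B) base.1)) =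
        τ base.1 (Function.update w j (act A base.1)) -
          τ base.1 (Function.update w j (act B base.1)) := by
    intro A B w j
    rw [← ContinuousAlternatingMap.map_update_sub, sub_eq_add_neg, act_add, ← neg_one_smul ℝ B,
      act_smul, neg_one_smul, sub_eq_add_neg]
  simp only [act_add, ContinuousAlternatingMap.map_update_add, Finset.sum_add_distrib,
    smul_add] at hsymm'
  simp only [hterm, hsub, Finset.sum_sub_distrib, mul_sub, smul_neg, Finset.sum_neg_distrib]
  simp only [zsmul_eq_mul, Int.cast_pow, Int.cast_neg, Int.cast_one] at hsymm' ⊢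
  change _ = (0 : ℝ) at hsymm'
  linarith

/-- The bracket of two elements of the basis of `𝔪` is, up to `𝔰𝔬(3)`, a multiple of an element of
the basis: `bracketCoeff` is the factor and `bracketIndex` the element. -/
def bracketIndex (i j : Fin 7) : Fin 7 :=
  if i = 0 then (if 4 ≤ j then j - 3 else j + 3)
  else if j = 0 then (if 4 ≤ i then i - 3 else i + 3) else 0

/-- The factor in the bracket of two elements of the basis of `𝔪`, see `bracketIndex`. -/
def bracketCoeff (i j : Fin 7) : ℤ :=
  if i = 0 then (if j = 0 then 0 else if 4 ≤ j then 1 else -1)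
  else if j = 0 then (if 4 ≤ i then -1 else 1)
  else if (j : ℕ) = i + 3 then -1 else if (i : ℕ) = j + 3 then 1 else 0

/-- The integral matrices underlying the basis of `𝔪`. -/
def mBasisInt (i : Fin 7) : Matrix (Fin 5) (Fin 5) ℤ := Matrix.of fun r s =>
  if r = (![0, 0, 0, 0, 1, 1, 1] : Fin 7 → Fin 5) i ∧ s = (![1, 2, 3, 4, 2, 3, 4] : Fin 7 → Fin 5) i
  then 1
  else if s = (![0, 0, 0, 0, 1, 1, 1] : Fin 7 → Fin 5) i ∧
    r = (![1, 2, 3, 4, 2, 3, 4] : Fin 7 → Fin 5) i then -1 else 0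

theorem mBasis_eq_map (i : Fin 7) : mBasis i = (mBasisInt i).map (Int.cast : ℤ → ℝ) := by
  ext r s
  fin_cases i <;> fin_cases r <;> fin_cases s <;> simp [mBasis, skew, mBasisInt]

/-- Only the first two columns are compared: they are the action on the base point, and the
𝔰𝔬(3)-part of a bracket does not meet them. -/
theorem mBasisInt_bracket : ∀ (i j : Fin 7) (l : Fin 5) (c : Fin 2),
    (mBasisInt i * mBasisInt j - mBasisInt j * mBasisInt i) l (c.castLE (by decide)) =
      bracketCoeff i j * mBasisInt (bracketIndex i j) l (c.castLE (by decide)) := by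
  decide +kernel

theorem act_base (A : Matrix (Fin 5) (Fin 5) ℝ) : act A base.1 = (A.col 0, A.col 1) := by
  simp [act_apply, base]

theorem act_bracket (i j : Fin 7) : act (mBasis i * mBasis j - mBasis j * mBasis i) base.1 =
    (bracketCoeff i j : ℝ) • (baseFrame (bracketIndex i j) : Amb) := by
  have h : mBasis i * mBasis j - mBasis j * mBasis i =
      (mBasisInt i * mBasisInt j - mBasisInt j * mBasisInt i).map (Int.cast : ℤ → ℝ) := by
    rw [mBasis_eq_map, mBasis_eq_map]
    ext r s
    simp [Matrix.mul_apply]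
  rw [baseFrame_apply, act_base, act_base, h, mBasis_eq_map]
  refine Prod.ext ?_ ?_ <;> ext l
  · have := congrArg (Int.cast (R := ℝ)) (mBasisInt_bracket i j l 0)
    rw [Int.cast_mul] at this
    exact this
  · have := congrArg (Int.cast (R := ℝ)) (mBasisInt_bracket i j l 1)
    rw [Int.cast_mul] at this
    exact this

theorem IsLocalExtension.apply_base {k : ℕ} {α : Form k} {τ : Amb → Amb [⋀^Fin k]→L[ℝ] ℝ}
    (h : IsLocalExtension α base τ) (w : Fin k → tangent base) :
    τ base.1 (fun i => (w i : Amb)) = α base w := by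
  obtain ⟨U, -, hp, -, hα⟩ := h
  rw [← hα base hp]
  rfl

/-- The exterior derivative of an invariant form at the base point, in terms of brackets. -/
theorem extDeriv_baseFrame {k : ℕ} {α : Form k} (hα : IsInvariant α)
    {τ : Amb → Amb [⋀^Fin k]→L[ℝ] ℝ} (h : IsLocalExtension α base τ) (v : Fin (k + 1) → Fin 7) :
    2 * restrictForm base (extDeriv τ base.1) (baseFrame ∘ v) =
      -∑ i : Fin (k + 1), (-1) ^ (i : ℕ) * ∑ j, bracketCoeff (v i) (i.removeNth v j) *
        α base (baseFrame ∘ Function.update (i.removeNth v) j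
          (bracketIndex (v i) (i.removeNth v j))) := by
  refine (extDeriv_apply_baseFrame hα h v).trans ?_
  congr 1
  refine Finset.sum_congr rfl fun i _ => ?_
  congr 1
  refine Finset.sum_congr rfl fun j _ => ?_
  rw [act_bracket, ContinuousAlternatingMap.map_update_smul, smul_eq_mul, ← h.apply_base]
  congr 2
  ext1 l
  rcases eq_or_ne l j with rfl | hl
  · simp
  · simp [hl]

end ExteriorDerivative

/-! ### The differential on coefficients -/

section Differentials

/-- The exterior derivative on the coefficients of invariant `3`-forms. -/
def dCoeff {R : Type*} [CommRing R] (q : Fin 5 → R) : Fin 5 → R :=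
  ![2 * q 0, 3 * q 2, 2 * q 3 - q 1, q 4 - 2 * q 2, -3 * q 3]

/-- Twice the exterior derivative of an invariant form with given integral values on the basis. -/
def dTable {k : ℕ} (T : (Fin k → Fin 7) → ℤ) (v : Fin (k + 1) → Fin 7) : ℤ :=
  -∑ i : Fin (k + 1), (-1) ^ (i : ℕ) * ∑ j, if bracketCoeff (v i) (i.removeNth v j) = 0 then 0 else
    bracketCoeff (v i) (i.removeNth v j) *
      T (Function.update (i.removeNth v) j (bracketIndex (v i) (i.removeNth v j)))

/-- Here de^1 = ω, so that d(e^1∧ω) = ω² is twice the basic form ω²/2. Since e_1 acts as an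
infinitesimal rotation mixing the two triples, d of a cubic is e^1 wedged with its derivative along
s∂_t − t∂_s. -/
theorem dTable_table3 : ∀ (m : Fin 5) (i j k l : Fin 7), i < j → j < k → k < l →
    dTable (table3 m) ![i, j, k, l] =
      2 * ∑ n, dCoeff (fun n => if n = m then 1 else 0) n * table4 n ![i, j, k, l] := by
  decide +kernel

/-- As ω is exact, ω² is closed. For a cubic C, dC is divisible by e^1, so d(e^1∧C) = ω∧C, and there
is no nonzero invariant 5-form without a factor e^1. -/
theorem dTable_table4 : ∀ (m : Fin 5) (i j k l r : Fin 7), i < j → j < k → k < l → l < r →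
    dTable (table4 m) ![i, j, k, l, r] = 0 := by
  decide +kernel

theorem dTable_cast {k : ℕ} (q : Fin 5 → ℝ) (T : Fin 5 → (Fin k → Fin 7) → ℤ)
    (v : Fin (k + 1) → Fin 7) :
    -∑ i : Fin (k + 1), (-1) ^ (i : ℕ) * ∑ j, (bracketCoeff (v i) (i.removeNth v j) : ℝ) *
        ∑ m, q m * (T m (Function.update (i.removeNth v) j
          (bracketIndex (v i) (i.removeNth v j))) : ℝ) = ∑ m, q m * (dTable (T m) v : ℝ) := by
  have h : ∀ m, dTable (T m) v = -∑ i : Fin (k + 1), (-1) ^ (i : ℕ) *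
      ∑ j, bracketCoeff (v i) (i.removeNth v j) *
      T m (Function.update (i.removeNth v) j (bracketIndex (v i) (i.removeNth v j))) := by
    intro m
    rw [dTable]
    congr 1
    refine Finset.sum_congr rfl fun i _ => ?_
    congr 1
    refine Finset.sum_congr rfl fun j _ => ?_
    split_ifs with h0
    · rw [h0, zero_mul]
    · rfl
  simp only [h]
  push_cast
  simp only [Finset.mul_sum, mul_neg, Finset.sum_neg_distrib]
  congr 1
  conv_rhs => rw [Finset.sum_comm]
  refine Finset.sum_congr rfl fun i _ => ?_
  conv_rhs => rw [Finset.sum_comm]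
  refine Finset.sum_congr rfl fun j _ => Finset.sum_congr rfl fun m _ => ?_
  ring

theorem extDeriv_form3 {α : Form 3} (hα : IsInvariant α) {q : Fin 5 → ℝ}
    (hq : α base = form3 baseFrame.coord q) {τ : Amb → Amb [⋀^Fin 3]→L[ℝ] ℝ}
    (h : IsLocalExtension α base τ) :
    restrictForm base (extDeriv τ base.1) = form4 baseFrame.coord (dCoeff q) := by
  refine ext_strictMono baseFrame fun v hv => ?_
  have h1 := extDeriv_baseFrame hα h v
  simp only [hq, form3_basis, dTable_cast] at h1
  rw [form4_basis]
  revert v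
  refine forall_strictMono fun i j k l hij hjk hkl => ?_
  intro h1
  have h2 := fun m => congrArg (Int.cast (R := ℝ)) (dTable_table3 m i j k l hij hjk hkl)
  simp only [h2] at h1
  simp [Fin.sum_univ_five, dCoeff] at h1 ⊢
  linarith

theorem extDeriv_form4 {α : Form 4} (hα : IsInvariant α) {q : Fin 5 → ℝ}
    (hq : α base = form4 baseFrame.coord q) {τ : Amb → Amb [⋀^Fin 4]→L[ℝ] ℝ}
    (h : IsLocalExtension α base τ) : restrictForm base (extDeriv τ base.1) = 0 := by
  refine ext_strictMono baseFrame fun v hv => ?_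
  have h1 := extDeriv_baseFrame hα h v
  have hv' : v = ![v 0, v 1, v 2, v 3, v 4] := by
    ext i
    fin_cases i <;> rfl
  have h2 : ∀ m, dTable (table4 m) v = 0 := fun m => by
    rw [hv']
    exact dTable_table4 m _ _ _ _ _ (hv (by decide)) (hv (by decide)) (hv (by decide))
      (hv (by decide))
  simp only [hq, form4_basis, dTable_cast, h2] at h1
  simpa using h1

end Differentials

/-! ### From the base point to the whole manifold -/

section Invariance

theorem rot_mul (g h : SO5) (p : Stiefel) : rot (g * h) p = rot g (rot h p) :=
  Subtype.ext (act_mul g.1 h.1 p.1)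

theorem rot_one (p : Stiefel) : rot 1 p = p :=
  Subtype.ext (act_one p.1)

theorem rot_inv {g : SO5} {p q : Stiefel} (h : rot g p = q) : rot g⁻¹ q = p := by
  rw [← h, ← rot_mul, inv_mul_cancel, rot_one]

theorem dRot_comp {g h : SO5} {p q r : Stiefel} (hg : rot g q = r) (hh : rot h p = q)
    (hgh : rot (g * h) p = r) : dRot g hg ∘ₗ dRot h hh = dRot (g * h) hgh := by
  ext1 w
  exact Subtype.ext (act_mul g.1 h.1 w.1).symm

theorem dRot_one {p : Stiefel} (h : rot 1 p = p) : dRot 1 h = LinearMap.id := by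
  ext1 w
  exact Subtype.ext (act_one w.1)

/-- The derivative of the translation by a rotation, as an isomorphism. -/
def dRotEquiv (g : SO5) {p q : Stiefel} (h : rot g p = q) : tangent p ≃ₗ[ℝ] tangent q :=
  LinearEquiv.ofLinearMap (dRot g h) (dRot g⁻¹ (rot_inv h))
    (by
      have h' : rot (g * g⁻¹) q = q := by rw [mul_inv_cancel, rot_one]
      rw [dRot_comp _ _ h']
      ext1 w
      refine Subtype.ext ?_
      change act (g * g⁻¹ : SO5).1 w.1 = w.1
      rw [mul_inv_cancel]
      exact act_one w.1)
    (by
      have h' : rot (g⁻¹ * g) p = p := by rw [inv_mul_cancel, rot_one]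
      rw [dRot_comp _ _ h']
      ext1 w
      refine Subtype.ext ?_
      change act (g⁻¹ * g : SO5).1 w.1 = w.1
      rw [inv_mul_cancel]
      exact act_one w.1)

theorem IsInvariant.comp_dRot {k : ℕ} {α : Form k} (hα : IsInvariant α) {g : SO5} {p q : Stiefel}
    (h : rot g p = q) : (α q).compLinearMap (dRot g h) = α p := by
  subst h
  exact hα g p

/-- A form at the base point is invariant under the stabiliser. -/
def IsStabilizerInvariant {k : ℕ} (α : (tangent base) [⋀^Fin k]→ₗ[ℝ] ℝ) : Prop :=
  ∀ (g : SO5) (h : rot g base = base), α.compLinearMap (dRot g h) = α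

/-- Two rotations that take p to the base point differ by an element of the stabiliser, so the
choice made in `invariantForm` is immaterial. -/
theorem IsStabilizerInvariant.invariantForm_apply {k : ℕ} {α : (tangent base) [⋀^Fin k]→ₗ[ℝ] ℝ}
    (hα : IsStabilizerInvariant α) {g : SO5} {p : Stiefel} (h : rot g p = base) :
    invariantForm α p = α.compLinearMap (dRot g h) := by
  have h0 := (exists_rot_eq_base p).choose_spec
  set g₀ := (exists_rot_eq_base p).choose with hg₀
  have h1 : rot (g * g₀⁻¹) base = base := by rw [rot_mul, rot_inv h0, h]
  have h2 : rot (g * g₀⁻¹ * g₀) p = base := by rw [inv_mul_cancel_right, h]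
  change α.compLinearMap (dRot g₀ h0) = _
  conv_lhs => rw [← hα _ h1]
  ext w
  simp only [AlternatingMap.compLinearMap_apply]
  congr 1
  ext1 i
  refine Subtype.ext ?_
  change act (g * g₀⁻¹ : SO5).1 (act g₀.1 _) = act g.1 _
  rw [← act_mul]
  congr 2
  exact congrArg Subtype.val (inv_mul_cancel_right g g₀)

theorem IsStabilizerInvariant.invariantForm_base {k : ℕ} {α : (tangent base) [⋀^Fin k]→ₗ[ℝ] ℝ}
    (hα : IsStabilizerInvariant α) : invariantForm α base = α := by
  rw [hα.invariantForm_apply (rot_one base), dRot_one]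
  rfl

theorem IsStabilizerInvariant.isInvariant {k : ℕ} {α : (tangent base) [⋀^Fin k]→ₗ[ℝ] ℝ}
    (hα : IsStabilizerInvariant α) : IsInvariant (invariantForm α) := by
  intro g p
  obtain ⟨h, hh⟩ := exists_rot_eq_base (rot g p)
  rw [hα.invariantForm_apply hh, hα.invariantForm_apply ((rot_mul h g p).trans hh),
    ← dRot_comp hh rfl]
  rfl

theorem IsLocalExtension.comp_rot {k : ℕ} {α : Form k} (hα : IsInvariant α) {g : SO5}
    {p q : Stiefel} (h : rot g p = q) {τ : Amb → Amb [⋀^Fin k]→L[ℝ] ℝ}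
    (hτ : IsLocalExtension α q τ) :
    IsLocalExtension α p fun x => (τ (act g.1 x)).compContinuousLinearMap
      (act g.1).toContinuousLinearMap := by
  obtain ⟨U, hU, hq, hs, hα'⟩ := hτ
  have hc : ContDiff ℝ ∞ (act g.1) := (act g.1).toContinuousLinearMap.contDiff
  refine ⟨act g.1 ⁻¹' U, hU.preimage hc.continuous, ?_, ?_, ?_⟩
  · change (rot g p).1 ∈ U
    rwa [h]
  · exact (ContinuousAlternatingMap.compContinuousLinearMapCLM
      (act g.1).toContinuousLinearMap).contDiff.comp_contDiffOn
      (hs.comp hc.contDiffOn fun _ h => h)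
  · intro r hr
    rw [← hα g r, ← hα' (rot g r) hr]
    rfl

theorem IsInvariant.isSmooth {k : ℕ} {α : Form k} (hα : IsInvariant α)
    (h : ∃ τ, IsLocalExtension α base τ) : IsSmooth α := by
  intro p
  obtain ⟨g, hg⟩ := exists_rot_eq_base p
  obtain ⟨τ, hτ⟩ := h
  exact ⟨_, hτ.comp_rot hα hg⟩

/-- Rotations act by linear maps of the ambient space, d commutes with pull-back, and the action is
transitive: the identity at the base point suffices. -/
theorem hasExtDeriv_of_base {k : ℕ} {α : Form k} {β : Form (k + 1)} (hα : IsInvariant α)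
    (hβ : IsInvariant β) {τ : Amb → Amb [⋀^Fin k]→L[ℝ] ℝ} (hτ : IsLocalExtension α base τ)
    (h : restrictForm base (extDeriv τ base.1) = β base) : HasExtDeriv α β := by
  intro p
  obtain ⟨g, hg⟩ := exists_rot_eq_base p
  refine ⟨_, hτ.comp_rot hα hg, ?_⟩
  rw [← hβ.comp_dRot hg, ← h]
  have hg' : act g.1 p.1 = base.1 := congrArg Subtype.val hg
  have hd : DifferentiableAt ℝ τ ((act g.1).toContinuousLinearMap p.1) := by
    change DifferentiableAt ℝ τ (act g.1 p.1)
    rw [hg']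
    exact hτ.differentiableAt
  have key := extDeriv_pullback (r := 2) hd
    (act g.1).toContinuousLinearMap.contDiff.contDiffAt (by simp)
  simp only [ContinuousLinearMap.fderiv] at key
  change _ = restrictForm p (extDeriv (fun x => (τ ((act g.1).toContinuousLinearMap
    x)).compContinuousLinearMap (act g.1).toContinuousLinearMap) p.1)
  rw [key]
  change _ = restrictForm p ((extDeriv τ (act g.1 p.1)).compContinuousLinearMap _)
  rw [hg']
  rfl

theorem form3_comp {W W' : Type*} [AddCommGroup W] [Module ℝ W] [AddCommGroup W'] [Module ℝ W']
    (θ : Fin 7 → W →ₗ[ℝ] ℝ) (q : Fin 5 → ℝ) (e : W' →ₗ[ℝ] W) :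
    (form3 θ q).compLinearMap e = form3 (fun i => θ i ∘ₗ e) q := by
  ext w
  simp only [AlternatingMap.compLinearMap_apply, form3_apply]
  rfl

theorem form4_comp {W W' : Type*} [AddCommGroup W] [Module ℝ W] [AddCommGroup W'] [Module ℝ W']
    (θ : Fin 7 → W →ₗ[ℝ] ℝ) (q : Fin 5 → ℝ) (e : W' →ₗ[ℝ] W) :
    (form4 θ q).compLinearMap e = form4 (fun i => θ i ∘ₗ e) q := by
  ext w
  simp only [AlternatingMap.compLinearMap_apply, form4_apply]
  rfl

theorem coord_map {W W' : Type*} [AddCommGroup W] [Module ℝ W] [AddCommGroup W'] [Module ℝ W']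
    (f : Module.Basis (Fin 7) ℝ W) (e : W' ≃ₗ[ℝ] W) :
    (f.map e.symm).coord = fun i => f.coord i ∘ₗ (e : W' →ₗ[ℝ] W) := by
  ext i w
  simp

/-- An invariant form with the model shape at the base point, and its dual. -/
theorem isDual_of_base {φ : Form 3} {ψ : Form 4} (hφ : IsInvariant φ) (hψ : IsInvariant ψ)
    {f : Module.Basis (Fin 7) ℝ (tangent base)} (h3 : φ base = g2Model f)
    (h4 : ψ base = form4 f.coord ![1, 0, -1, 0, 1]) : IsDual φ ψ := by
  intro p
  obtain ⟨g, hg⟩ := exists_rot_eq_base p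
  have h3' : φ p = g2Model (f.map (dRotEquiv g hg).symm) := by
    rw [← hφ.comp_dRot hg, h3, g2Model_eq_form3, g2Model_eq_form3, form3_comp, coord_map]
    rfl
  refine ⟨f.map (dRotEquiv g hg).symm, h3', ?_⟩
  rw [h3', hodgeStar_g2Model, coord_map, ← hψ.comp_dRot hg, h4, form4_comp]
  rfl

end Invariance

/-! ### Smoothness of invariant forms through a local section of SO(5) → V -/

section Smoothness

/-- The reflection along `n`, if `c * (n ⬝ᵥ n) = 2`. -/
def refl (c : ℝ) (n : Fin 5 → ℝ) : Matrix (Fin 5) (Fin 5) ℝ := 1 - c • Matrix.vecMulVec n n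

theorem refl_mulVec (c : ℝ) (n w : Fin 5 → ℝ) : refl c n *ᵥ w = w - (c * (n ⬝ᵥ w)) • n := by
  ext i
  simp [refl, Matrix.sub_mulVec, Matrix.smul_mulVec, Matrix.vecMulVec_mulVec]
  ring

theorem refl_transpose (c : ℝ) (n : Fin 5 → ℝ) : (refl c n)ᵀ = refl c n := by
  simp [refl, Matrix.transpose_vecMulVec]

theorem refl_mul_self {c : ℝ} {n : Fin 5 → ℝ} (h : c * (n ⬝ᵥ n) = 2) : refl c n * refl c n = 1 := by
  refine Matrix.ext_of_mulVec_single fun i => ?_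
  rw [← Matrix.mulVec_mulVec, refl_mulVec, refl_mulVec, Matrix.one_mulVec]
  ext j
  simp only [dotProduct_sub, dotProduct_smul, Pi.sub_apply, Pi.smul_apply, smul_eq_mul]
  linear_combination c * (n ⬝ᵥ Pi.single i 1) * n j * h

theorem det_refl {c : ℝ} {n : Fin 5 → ℝ} (h : c * (n ⬝ᵥ n) = 2) : (refl c n).det = -1 := by
  have h' : refl c n = 1 + Matrix.replicateCol Unit (-c • n) * Matrix.replicateRow Unit n := by
    ext i j
    simp [refl, Matrix.mul_apply, Matrix.vecMulVec_apply, sub_eq_add_neg, mul_assoc]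
  rw [h', Matrix.det_one_add_replicateCol_mul_replicateRow, dotProduct_smul, smul_eq_mul]
  linarith

/-- The rotation in the plane of the unit vectors `u` and `e` that maps `u` to `e`. -/
def rotTo (u e : Fin 5 → ℝ) : Matrix (Fin 5) (Fin 5) ℝ := refl 2 e * refl (1 / (1 + u ⬝ᵥ e)) (u + e)

theorem rotTo_aux {u e : Fin 5 → ℝ} (hu : u ⬝ᵥ u = 1) (he : e ⬝ᵥ e = 1) (hue : 1 + u ⬝ᵥ e ≠ 0) :
    1 / (1 + u ⬝ᵥ e) * ((u + e) ⬝ᵥ (u + e)) = 2 := by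
  rw [add_dotProduct, dotProduct_add, dotProduct_add, hu, he, dotProduct_comm e u]
  field_simp
  ring

theorem rotTo_mem {u e : Fin 5 → ℝ} (hu : u ⬝ᵥ u = 1) (he : e ⬝ᵥ e = 1) (hue : 1 + u ⬝ᵥ e ≠ 0) :
    rotTo u e ∈ Matrix.specialOrthogonalGroup (Fin 5) ℝ := by
  have h1 : (2 : ℝ) * (e ⬝ᵥ e) = 2 := by rw [he, mul_one]
  have h2 := rotTo_aux hu he hue
  refine Matrix.mem_specialOrthogonalGroup_iff.2
    ⟨(Matrix.mem_orthogonalGroup_iff (Fin 5) ℝ).2 ?_, ?_⟩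
  · change rotTo u e * (rotTo u e)ᵀ = 1
    rw [rotTo, Matrix.transpose_mul, refl_transpose, refl_transpose, ← Matrix.mul_assoc,
      Matrix.mul_assoc (refl 2 e), refl_mul_self h2, Matrix.mul_one, refl_mul_self h1]
  · rw [rotTo, Matrix.det_mul, det_refl h1, det_refl h2]
    norm_num

theorem rotTo_mulVec_self {u e : Fin 5 → ℝ} (hu : u ⬝ᵥ u = 1) (he : e ⬝ᵥ e = 1)
    (hue : 1 + u ⬝ᵥ e ≠ 0) : rotTo u e *ᵥ u = e := by
  have h : refl (1 / (1 + u ⬝ᵥ e)) (u + e) *ᵥ u = -e := by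
    rw [refl_mulVec, add_dotProduct, hu, dotProduct_comm e u, one_div_mul_cancel hue, one_smul]
    abel
  rw [rotTo, ← Matrix.mulVec_mulVec, h, refl_mulVec, dotProduct_neg, he]
  module

/-- Ensures that the second rotation in `frameTo`, which moves the image of v to ε₂, leaves ε₁ where
the first one has put it. -/
theorem rotTo_mulVec_of_orthogonal {u e w : Fin 5 → ℝ} (hu : u ⬝ᵥ w = 0) (he : e ⬝ᵥ w = 0) :
    rotTo u e *ᵥ w = w := by
  rw [rotTo, ← Matrix.mulVec_mulVec, refl_mulVec _ (u + e), add_dotProduct, hu, he]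
  simp [refl_mulVec, he]

/-- A smooth local section of `SO(5) → V^{5,2}`: `frameTo x` maps `x` to the base point. -/
def frameTo (x : Amb) : Matrix (Fin 5) (Fin 5) ℝ :=
  rotTo (rotTo x.1 (Pi.single 0 1) *ᵥ x.2) (Pi.single 1 1) * rotTo x.1 (Pi.single 0 1)

/-- The domain of the local section. -/
def frameDomain : Set Amb :=
  {x | 1 + x.1 ⬝ᵥ Pi.single 0 1 ≠ 0} ∩
    {x | 1 + (rotTo x.1 (Pi.single 0 1) *ᵥ x.2) ⬝ᵥ Pi.single 1 1 ≠ 0}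

theorem exists_frameTo {q : Stiefel} (hq : q.1 ∈ frameDomain) :
    ∃ h : frameTo q.1 ∈ Matrix.specialOrthogonalGroup (Fin 5) ℝ, rot ⟨_, h⟩ q = base := by
  obtain ⟨⟨u, v⟩, hu, hv, huv⟩ := q
  obtain ⟨h1, h2⟩ := hq
  simp only [Set.mem_ofPred_eq] at hu hv huv h1 h2
  have he0 : (Pi.single 0 1 : Fin 5 → ℝ) ⬝ᵥ Pi.single 0 1 = 1 := by simp
  have he1 : (Pi.single 1 1 : Fin 5 → ℝ) ⬝ᵥ Pi.single 1 1 = 1 := by simp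
  have hm := rotTo_mem hu he0 h1
  have hu' := rotTo_mulVec_self hu he0 h1
  have hv' : (rotTo u (Pi.single 0 1) *ᵥ v) ⬝ᵥ (rotTo u (Pi.single 0 1) *ᵥ v) = 1 :=
    (dotProduct_rot ⟨_, hm⟩ v v).trans hv
  have huv' : (rotTo u (Pi.single 0 1) *ᵥ v) ⬝ᵥ Pi.single 0 1 = 0 := by
    have := (dotProduct_rot ⟨_, hm⟩ v u).trans ((dotProduct_comm v u).trans huv)
    rwa [hu'] at this
  refine ⟨mul_mem (rotTo_mem hv' he1 h2) hm, Subtype.ext ?_⟩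
  change (frameTo (u, v) *ᵥ u, frameTo (u, v) *ᵥ v) = (Pi.single 0 1, Pi.single 1 1)
  rw [frameTo, ← Matrix.mulVec_mulVec, ← Matrix.mulVec_mulVec, hu',
    rotTo_mulVec_of_orthogonal huv' (by simp), rotTo_mulVec_self hv' he1 h2]

theorem contDiffOn_dotProduct {f g : Amb → Fin 5 → ℝ} {U : Set Amb} (hf : ContDiffOn ℝ ∞ f U)
    (hg : ContDiffOn ℝ ∞ g U) : ContDiffOn ℝ ∞ (fun x => f x ⬝ᵥ g x) U := by
  simp only [dotProduct]
  exact ContDiffOn.sum fun i _ => (contDiffOn_pi.1 hf i).mul (contDiffOn_pi.1 hg i)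

theorem contDiffOn_rotTo {u w : Amb → Fin 5 → ℝ} (e : Fin 5 → ℝ) {U : Set Amb}
    (hu : ContDiffOn ℝ ∞ u U) (hw : ContDiffOn ℝ ∞ w U) (hU : ∀ x ∈ U, 1 + u x ⬝ᵥ e ≠ 0) :
    ContDiffOn ℝ ∞ (fun x => rotTo (u x) e *ᵥ w x) U := by
  have he : ContDiffOn ℝ ∞ (fun _ : Amb => e) U := contDiffOn_const
  simp only [rotTo, ← Matrix.mulVec_mulVec, refl_mulVec]
  have h1 : ContDiffOn ℝ ∞ (fun x => 1 / (1 + u x ⬝ᵥ e)) U :=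
    contDiffOn_const.div (contDiffOn_const.add (contDiffOn_dotProduct hu he)) hU
  have h2 : ContDiffOn ℝ ∞
      (fun x => w x - (1 / (1 + u x ⬝ᵥ e) * ((u x + e) ⬝ᵥ w x)) • (u x + e)) U :=
    hw.sub ((h1.mul (contDiffOn_dotProduct (hu.add he) hw)).smul (hu.add he))
  exact h2.sub ((contDiffOn_const.mul (contDiffOn_dotProduct he h2)).smul he)

theorem contDiffOn_rotTo_fst {w : Amb → Fin 5 → ℝ} {U : Set Amb} (hw : ContDiffOn ℝ ∞ w U)
    (hU : U ⊆ {x | 1 + x.1 ⬝ᵥ Pi.single 0 1 ≠ 0}) :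
    ContDiffOn ℝ ∞ (fun x => rotTo x.1 (Pi.single 0 1) *ᵥ w x) U :=
  contDiffOn_rotTo _ contDiff_fst.contDiffOn hw hU

theorem contDiffOn_frameTo (w : Fin 5 → ℝ) :
    ContDiffOn ℝ ∞ (fun x => frameTo x *ᵥ w) frameDomain := by
  simp only [frameTo, ← Matrix.mulVec_mulVec]
  exact contDiffOn_rotTo _
    (contDiffOn_rotTo_fst contDiff_snd.contDiffOn fun x hx => hx.1)
    (contDiffOn_rotTo_fst contDiffOn_const fun x hx => hx.1) fun x hx => hx.2

theorem isOpen_frameDomain : IsOpen frameDomain := by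
  have h1 : IsOpen {x : Amb | 1 + x.1 ⬝ᵥ Pi.single 0 1 ≠ 0} := by
    have : Continuous fun x : Amb => 1 + x.1 ⬝ᵥ Pi.single 0 1 := by
      simp only [dotProduct_single, mul_one]
      fun_prop
    exact isOpen_ne.preimage this
  have h2 : ContinuousOn (fun x : Amb =>
      1 + (rotTo x.1 (Pi.single 0 1) *ᵥ x.2) ⬝ᵥ Pi.single 1 1)
      {x : Amb | 1 + x.1 ⬝ᵥ Pi.single 0 1 ≠ 0} :=
    (contDiffOn_const.add (contDiffOn_dotProduct
      (contDiffOn_rotTo_fst contDiff_snd.contDiffOn subset_rfl) contDiffOn_const)).continuousOn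
  exact h2.isOpen_inter_preimage h1 isOpen_ne

theorem base_mem_frameDomain : base.1 ∈ frameDomain := by
  have h : rotTo (Pi.single 0 1) (Pi.single 0 1) *ᵥ Pi.single 1 1 = (Pi.single 1 1 : Fin 5 → ℝ) :=
    rotTo_mulVec_of_orthogonal (by simp) (by simp)
  constructor
  · change (1 : ℝ) + Pi.single 0 1 ⬝ᵥ Pi.single 0 1 ≠ 0
    simp
  · change (1 : ℝ) + (rotTo (Pi.single 0 1) (Pi.single 0 1) *ᵥ Pi.single 1 1) ⬝ᵥ Pi.single 1 1 ≠ 0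
    rw [h]
    simp

/-- A family of alternating forms on a finite-dimensional space is smooth if its values are. -/
theorem contDiffOn_alternating {k : ℕ} {τ : Amb → Amb [⋀^Fin k]→L[ℝ] ℝ} {U : Set Amb}
    (h : ∀ v, ContDiffOn ℝ ∞ (fun x => τ x v) U) : ContDiffOn ℝ ∞ τ U := by
  let b := Module.finBasis ℝ Amb
  let ev : (Amb [⋀^Fin k]→L[ℝ] ℝ) →ₗ[ℝ] ((Fin k → Fin (Module.finrank ℝ Amb)) → ℝ) :=
    { toFun := fun α v => α (b ∘ v)
      map_add' := fun _ _ => rfl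
      map_smul' := fun _ _ => rfl }
  have hinj : LinearMap.ker ev = ⊥ := by
    refine LinearMap.ker_eq_bot.2 fun α β hαβ => ?_
    refine ContinuousAlternatingMap.toAlternatingMap_injective ?_
    exact Module.Basis.ext_alternating b fun v _ => congrFun hαβ v
  -- A linear left inverse of evaluation on basis tuples recovers the form smoothly from its values.
  obtain ⟨g, hg⟩ := ev.exists_leftInverse_of_injective hinj
  have hτ : τ = fun x => g.toContinuousLinearMap (ev (τ x)) :=
    funext fun x => (LinearMap.congr_fun hg (τ x)).symm
  rw [hτ]
  exact g.toContinuousLinearMap.contDiff.comp_contDiffOn (contDiffOn_pi.2 fun v => h (b ∘ v))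

theorem continuous_alternating {k : ℕ} (γ : Amb [⋀^Fin k]→ₗ[ℝ] ℝ) : Continuous γ := by
  let b := Module.finBasis ℝ Amb
  have h : ∀ w, γ w = ∑ v : Fin k → Fin (Module.finrank ℝ Amb),
      (∏ i, b.coord (v i) (w i)) * γ (b ∘ v) := by
    intro w
    have hw : w = fun i => ∑ j, b.coord j (w i) • b j := by
      ext1 i
      exact (b.sum_repr (w i)).symm
    conv_lhs => rw [hw]
    change γ.toMultilinearMap _ = _
    rw [MultilinearMap.map_sum]
    refine Finset.sum_congr rfl fun v _ => ?_
    rw [MultilinearMap.map_smul_univ]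
    rfl
  have h' : ⇑γ = fun w => ∑ v : Fin k → Fin (Module.finrank ℝ Amb),
      (∏ i, b.coord (v i) (w i)) * γ (b ∘ v) := funext h
  rw [h']
  refine continuous_finsetSum _ fun v _ => Continuous.mul ?_ continuous_const
  exact continuous_finsetProd _ fun i _ =>
    (LinearMap.continuous_of_finiteDimensional (b.coord (v i))).comp (continuous_apply i)

theorem exists_isLocalExtension {k : ℕ} {α : (tangent base) [⋀^Fin k]→ₗ[ℝ] ℝ}
    (hα : IsStabilizerInvariant α) : ∃ τ, IsLocalExtension (invariantForm α) base τ := by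
  -- Any linear projection onto the tangent space will do: P only extends α to the ambient space.
  obtain ⟨P, hP⟩ := (tangent base).subtype.exists_leftInverse_of_injective (by simp)
  have hc : Continuous (α.compLinearMap P) := continuous_alternating _
  let A : Amb [⋀^Fin k]→L[ℝ] ℝ := { α.compLinearMap P with cont := hc }
  refine ⟨fun x => A.compContinuousLinearMap (act (frameTo x)).toContinuousLinearMap, frameDomain,
    isOpen_frameDomain, base_mem_frameDomain, ?_, ?_⟩
  · refine contDiffOn_alternating fun v => ?_
    refine A.toContinuousMultilinearMap.contDiff.comp_contDiffOn (contDiffOn_pi.2 fun i => ?_)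
    exact (contDiffOn_frameTo (v i).1).prodMk (contDiffOn_frameTo (v i).2)
  · intro q hq
    obtain ⟨h, hb⟩ := exists_frameTo hq
    rw [hα.invariantForm_apply hb]
    ext w
    change α (fun i => P (act (frameTo q.1) (w i))) = α fun i => dRot _ hb (w i)
    congr 1
    ext1 i
    exact LinearMap.congr_fun hP (dRot _ hb (w i))

theorem isSmooth_invariantForm {k : ℕ} {α : (tangent base) [⋀^Fin k]→ₗ[ℝ] ℝ}
    (hα : IsStabilizerInvariant α) : IsSmooth (invariantForm α) :=
  hα.isInvariant.isSmooth (exists_isLocalExtension hα)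

end Smoothness

/-! ### Invariance of the basic forms under the stabiliser -/

section Base

theorem coord_base (w : tangent base) : (baseFrame.coord · w) =
    ![w.1.2 0, -w.1.1 2, -w.1.1 3, -w.1.1 4, -w.1.2 2, -w.1.2 3, -w.1.2 4] := by
  ext k
  rw [Module.Basis.coord_apply, baseFrame, Module.Basis.ofEquivFun_repr_apply]
  rfl

/-- The determinant of `ε₁, ε₂, a, b, c`. -/
def frameDet (a b c : Fin 5 → ℝ) : ℝ :=
  Matrix.det (Matrix.of ![Pi.single 0 1, Pi.single 1 1, a, b, c])

theorem frameDet_eq (a b c : Fin 5 → ℝ) :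
    frameDet a b c = -det3 (-a 2) (-a 3) (-a 4) (-b 2) (-b 3) (-b 4) (-c 2) (-c 3) (-c 4) := by
  simp [frameDet, Matrix.det_succ_row_zero, Fin.sum_univ_succ, Fin.succAbove, det3]
  ring

theorem frameDet_rot {g : SO5} (h : rot g base = base) (a b c : Fin 5 → ℝ) :
    frameDet (g.1 *ᵥ a) (g.1 *ᵥ b) (g.1 *ᵥ c) = frameDet a b c := by
  have h0 : g.1 *ᵥ Pi.single 0 1 = Pi.single 0 1 := congrArg (fun p : Stiefel => p.1.1) h
  have h1 : g.1 *ᵥ Pi.single 1 1 = Pi.single 1 1 := congrArg (fun p : Stiefel => p.1.2) h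
  have hm : Matrix.of ![Pi.single 0 1, Pi.single 1 1, g.1 *ᵥ a, g.1 *ᵥ b, g.1 *ᵥ c] =
      Matrix.of ![Pi.single 0 1, Pi.single 1 1, a, b, c] * (g.1)ᵀ := by
    ext i j
    rw [Matrix.mul_apply]
    fin_cases i
    · conv_lhs => rw [← h0]
      simp [Matrix.mulVec, dotProduct, Pi.single_apply]
    · conv_lhs => rw [← h1]
      simp [Matrix.mulVec, dotProduct, Pi.single_apply]
    all_goals simp [Matrix.mulVec, dotProduct, mul_comm]
  rw [frameDet, hm, Matrix.det_mul, Matrix.det_transpose,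
    (Matrix.mem_specialOrthogonalGroup_iff.1 g.2).2, mul_one, frameDet]

/-- Five-dimensional determinants containing ε₁ and ε₂ are visibly invariant under the stabiliser.
The signs come from the coordinates, which are negatives of vector components. -/
theorem tri_coord (m : Fin 4) (u v w : tangent base) :
    tri m (baseFrame.coord · u) (baseFrame.coord · v) (baseFrame.coord · w) =
      ![-frameDet u.1.1 v.1.1 w.1.1,
        -frameDet u.1.2 v.1.1 w.1.1 - frameDet u.1.1 v.1.2 w.1.1 - frameDet u.1.1 v.1.1 w.1.2,
        -frameDet u.1.1 v.1.2 w.1.2 - frameDet u.1.2 v.1.1 w.1.2 - frameDet u.1.2 v.1.2 w.1.1,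
        -frameDet u.1.2 v.1.2 w.1.2] m := by
  rw [coord_base, coord_base, coord_base]
  simp only [frameDet_eq, neg_neg, sub_neg_eq_add]
  fin_cases m <;> simp [tri]

/-- Euclidean inner products make the invariance evident; the first two components drop out by
tangency. -/
theorem om_coord (u v : tangent base) :
    om (baseFrame.coord · u) (baseFrame.coord · v) = u.1.1 ⬝ᵥ v.1.2 - v.1.1 ⬝ᵥ u.1.2 := by
  obtain ⟨h1, h2, -⟩ := mem_tangent_base.1 u.2
  obtain ⟨h3, h4, -⟩ := mem_tangent_base.1 v.2
  rw [coord_base, coord_base]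
  simp [om, dotProduct, Fin.sum_univ_five, h1, h2, h3, h4]
  ring

section
variable {g : SO5} (h : rot g base = base)

theorem tri_dRot (m : Fin 4) (u v w : tangent base) :
    tri m (baseFrame.coord · (dRot g h u)) (baseFrame.coord · (dRot g h v))
      (baseFrame.coord · (dRot g h w)) =
      tri m (baseFrame.coord · u) (baseFrame.coord · v) (baseFrame.coord · w) := by
  have h1 : ∀ u, (dRot g h u).1.1 = g.1 *ᵥ u.1.1 := fun _ => rfl
  have h2 : ∀ u, (dRot g h u).1.2 = g.1 *ᵥ u.1.2 := fun _ => rfl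
  rw [tri_coord, tri_coord]
  simp only [h1, h2, frameDet_rot h]

theorem om_dRot (u v : tangent base) :
    om (baseFrame.coord · (dRot g h u)) (baseFrame.coord · (dRot g h v)) =
      om (baseFrame.coord · u) (baseFrame.coord · v) := by
  rw [om_coord, om_coord]
  exact congrArg₂ (· - ·) (dotProduct_rot g _ _) (dotProduct_rot g _ _)

theorem coord_zero_dRot (u : tangent base) :
    baseFrame.coord 0 (dRot g h u) = baseFrame.coord 0 u := by
  have h0 : g.1 *ᵥ Pi.single 0 1 = Pi.single 0 1 := congrArg (fun p : Stiefel => p.1.1) h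
  have hc : ∀ u : tangent base, baseFrame.coord 0 u = Pi.single 0 1 ⬝ᵥ u.1.2 := fun u => by
    rw [congrFun (coord_base u) 0]
    simp
  rw [hc, hc]
  conv_rhs => rw [← dotProduct_rot g, h0]
  rfl

end

theorem form3_stabilizerInvariant (q : Fin 5 → ℝ) :
    IsStabilizerInvariant (form3 baseFrame.coord q) := by
  intro g h
  ext w
  rw [AlternatingMap.compLinearMap_apply, form3_apply, form3_apply]
  simp only [inv3, cubic, tri_dRot, om_dRot, coord_zero_dRot]

theorem form4_stabilizerInvariant (q : Fin 5 → ℝ) :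
    IsStabilizerInvariant (form4 baseFrame.coord q) := by
  intro g h
  ext w
  rw [AlternatingMap.compLinearMap_apply, form4_apply, form4_apply]
  simp only [inv4, cubic, tri_dRot, om_dRot, coord_zero_dRot]

end Base

/-! ### Scaling the coframe and rotating the factor ℝ² -/

section AdaptedFrame

/-- Change of coordinates from `e^1, …, e^7` to an adapted coframe. -/
def adapt (k₁ k₂ k₃ m n : ℝ) (w : Fin 7 → ℝ) : Fin 7 → ℝ :=
  ![-(k₁ * w 0), m * (k₂ * w 1) - n * (k₃ * w 4), m * (k₂ * w 2) - n * (k₃ * w 5),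
    m * (k₂ * w 3) - n * (k₃ * w 6), n * (k₂ * w 1) + m * (k₃ * w 4),
    n * (k₂ * w 2) + m * (k₃ * w 5), n * (k₂ * w 3) + m * (k₃ * w 6)]

/-- `adapt` as an isomorphism. -/
def adaptEquiv {k₁ k₂ k₃ m n : ℝ} (h₁ : k₁ ≠ 0) (h₂ : k₂ ≠ 0) (h₃ : k₃ ≠ 0)
    (hmn : m ^ 2 + n ^ 2 = 1) : (Fin 7 → ℝ) ≃ₗ[ℝ] (Fin 7 → ℝ) where
  toFun := adapt k₁ k₂ k₃ m n
  map_add' u v := by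
    ext i
    fin_cases i <;> simp [adapt] <;> ring
  map_smul' c u := by
    ext i
    fin_cases i <;> simp [adapt] <;> ring
  invFun w := ![-(w 0 / k₁), (m * w 1 + n * w 4) / k₂, (m * w 2 + n * w 5) / k₂,
    (m * w 3 + n * w 6) / k₂, (m * w 4 - n * w 1) / k₃, (m * w 5 - n * w 2) / k₃,
    (m * w 6 - n * w 3) / k₃]
  left_inv w := by
    ext i
    fin_cases i <;> simp [adapt] <;> field_simp
    · linear_combination k₂ * w 1 * hmn
    · linear_combination k₂ * w 2 * hmn
    · linear_combination k₂ * w 3 * hmn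
    · linear_combination k₃ * w 4 * hmn
    · linear_combination k₃ * w 5 * hmn
    · linear_combination k₃ * w 6 * hmn
  right_inv w := by
    ext i
    fin_cases i <;> simp [adapt] <;> field_simp
    · linear_combination w 1 * hmn
    · linear_combination w 2 * hmn
    · linear_combination w 3 * hmn
    · linear_combination w 4 * hmn
    · linear_combination w 5 * hmn
    · linear_combination w 6 * hmn

theorem om_adapt {k₁ k₂ k₃ m n : ℝ} (hmn : m ^ 2 + n ^ 2 = 1) (u v : Fin 7 → ℝ) :
    om (adapt k₁ k₂ k₃ m n u) (adapt k₁ k₂ k₃ m n v) = k₂ * k₃ * om u v := by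
  simp [adapt, om]
  linear_combination k₂ * k₃ * (u 1 * v 4 - u 4 * v 1 + (u 2 * v 5 - u 5 * v 2) +
    (u 3 * v 6 - u 6 * v 3)) * hmn

/-- Rotating ℝ² by m + in multiplies (s + it)³ by (m + in)³, whose real part and negated imaginary
part are the coefficients. The entries c and d do not enter `cubic` and are free. -/
theorem cubic_adapt (k₁ k₂ k₃ m n c d : ℝ) (u v w : Fin 7 → ℝ) :
    cubic ![c, 1, 0, -1, 0] (adapt k₁ k₂ k₃ m n u) (adapt k₁ k₂ k₃ m n v) (adapt k₁ k₂ k₃ m n w) =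
      cubic ![d, k₂ ^ 3 * (m ^ 3 - 3 * m * n ^ 2), k₂ ^ 2 * k₃ * (n ^ 3 - 3 * m ^ 2 * n),
        -(k₂ * k₃ ^ 2 * (m ^ 3 - 3 * m * n ^ 2)), -(k₃ ^ 3 * (n ^ 3 - 3 * m ^ 2 * n))] u v w := by
  simp [adapt, cubic, tri, det3]
  ring

theorem cubic_adapt' (k₁ k₂ k₃ m n c d : ℝ) (u v w : Fin 7 → ℝ) :
    cubic ![c, 0, -1, 0, 1] (adapt k₁ k₂ k₃ m n u) (adapt k₁ k₂ k₃ m n v) (adapt k₁ k₂ k₃ m n w) =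
      cubic ![d, k₂ ^ 3 * (n ^ 3 - 3 * m ^ 2 * n), -(k₂ ^ 2 * k₃ * (m ^ 3 - 3 * m * n ^ 2)),
        -(k₂ * k₃ ^ 2 * (n ^ 3 - 3 * m ^ 2 * n)), k₃ ^ 3 * (m ^ 3 - 3 * m * n ^ 2)] u v w := by
  simp [adapt, cubic, tri, det3]
  ring

end AdaptedFrame

/-! ### The explicit family and its adapted bases -/

section Family

/-- Passing to the sixth roots s, t of b² + ax and a² + by turns all radicals of the family into
monomials in s and t. -/
theorem exists_scales {a b x y : ℝ} (hP : 0 < a ^ 2 + b * y) (hQ : 0 < b ^ 2 + a * x) :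
    ∃ s t : ℝ, 0 < s ∧ 0 < t ∧ s ^ 6 = b ^ 2 + a * x ∧ t ^ 6 = a ^ 2 + b * y ∧
      √(a ^ 2 + b * y) = t ^ 3 ∧ √(b ^ 2 + a * x) = s ^ 3 ∧ √(y2 a b x y) = s ^ 2 / t ∧
      √(y3 a b x y) = t ^ 2 / s ∧ √(y2 a b x y * y3 a b x y) = s * t := by
  have root : ∀ r : ℝ, 0 < r → ∃ s : ℝ, 0 < s ∧ s ^ 6 = r ∧ √r = s ^ 3 ∧
      r ^ (2 / 3 : ℝ) = s ^ 4 ∧ r ^ (1 / 3 : ℝ) = s ^ 2 := by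
    intro r hr
    have hs : 0 < r ^ (1 / 6 : ℝ) := Real.rpow_pos_of_pos hr _
    have hpow : ∀ n : ℕ, (r ^ (1 / 6 : ℝ)) ^ n = r ^ ((n : ℝ) / 6) := fun n => by
      rw [← Real.rpow_natCast, ← Real.rpow_mul hr.le]
      congr 1
      ring
    have h6 : (r ^ (1 / 6 : ℝ)) ^ 6 = r := by
      rw [hpow]
      norm_num
    refine ⟨_, hs, h6, ?_, ?_, ?_⟩
    · rw [← Real.sqrt_sq (pow_nonneg hs.le 3)]
      congr 1
      rw [← pow_mul]
      exact h6.symm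
    · rw [hpow]
      norm_num
    · rw [hpow]
      norm_num
  obtain ⟨s, hs, hs6, hs3, hs4, hs2⟩ := root _ hQ
  obtain ⟨t, ht, ht6, ht3, ht4, ht2⟩ := root _ hP
  have h2 : y2 a b x y = (s ^ 2 / t) ^ 2 := by
    rw [y2, hs4, ht2]
    ring
  have h3 : y3 a b x y = (t ^ 2 / s) ^ 2 := by
    rw [y3, ht4, hs2]
    ring
  refine ⟨s, t, hs, ht, hs6, ht6, ht3, hs3, ?_, ?_, ?_⟩
  · rw [h2, Real.sqrt_sq (by positivity)]
  · rw [h3, Real.sqrt_sq (by positivity)]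
  · rw [h2, h3, ← mul_pow, Real.sqrt_sq (by positivity)]
    field_simp

theorem mono_smul {W : Type*} [AddCommGroup W] [Module ℝ W] {n k : ℕ} (c : Fin n → ℝ)
    (θ : Fin n → W →ₗ[ℝ] ℝ) (I : Fin k → Fin n) (w : Fin k → W) :
    mono (fun i => c i • θ i) I w = (∏ j, c (I j)) * mono θ I w := by
  rw [mono_apply, mono_apply, ← Matrix.det_mul_row]
  rfl

/-- The scalings of the X^i cancel the radicals in p₁, …, p₄. -/
theorem phiBase_eq {a b x y z : ℝ} (hP : 0 < a ^ 2 + b * y) (hQ : 0 < b ^ 2 + a * x) :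
    phiBase a b x y z = form3 baseFrame.coord ![-z, x, b, -a, -y] := by
  obtain ⟨s, t, hs, ht, hs6, ht6, hsP, hsQ, h2, h3, h23⟩ := exists_scales hP hQ
  ext w
  have hX : coframe a b x y z = fun i => (![z / (s * t), s ^ 2 / t, s ^ 2 / t, s ^ 2 / t,
      t ^ 2 / s, t ^ 2 / s, t ^ 2 / s] : Fin 7 → ℝ) i • baseFrame.coord i := by
    unfold coframe
    rw [h2, h3, h23]
  simp only [phiBase, hX, hsP, hsQ]
  simp only [← hs6, ← ht6, form3, alternating_sum_apply,
    AlternatingMap.smul_apply, AlternatingMap.add_apply, AlternatingMap.sub_apply,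
    AlternatingMap.neg_apply, mono_smul, smul_eq_mul, Fin.sum_univ_succ, Fin.prod_univ_three]
  simp [kind, sign3, index3]
  field_simp
  ring

/-- The coefficients of the dual of an adapted form. -/
def dualCoeff (a b z s t : ℝ) : Fin 5 → ℝ :=
  ![(s * t) ^ 2, -(z / (s * t) * (s ^ 3 * b / t ^ 3)), z / (s * t) * (s ^ 3 * a / t ^ 3),
    z / (s * t) * (t ^ 3 * b / s ^ 3), -(z / (s * t) * (t ^ 3 * a / s ^ 3))]

/-- In the coframe X the cubic has coefficients (p₁, p₃, −p₂, −p₄). The condition xy = ab gives p₁ =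
p₂, p₄ = p₃ and p₂² + p₃² = 1, so it is Re((p₂ − i p₃)(s + it)³), which a rotation brings to the
model. The first covector changes sign to absorb the minus sign of X^1∧ω. -/
theorem exists_adapted_basis {a b x y z s t : ℝ} (hs : 0 < s) (ht : 0 < t) (hz : z ≠ 0)
    (hxy : x * y = a * b) (hs6 : s ^ 6 = b ^ 2 + a * x) (ht6 : t ^ 6 = a ^ 2 + b * y) :
    ∃ f : Module.Basis (Fin 7) ℝ (tangent base),
      form3 baseFrame.coord ![-z, x, b, -a, -y] = g2Model f ∧
      form4 baseFrame.coord (dualCoeff a b z s t) = form4 f.coord ![1, 0, -1, 0, 1] := by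
  have hx : x * t ^ 6 = a * s ^ 6 := by
    rw [hs6, ht6]
    linear_combination b * hxy
  have hy : y * s ^ 6 = b * t ^ 6 := by
    rw [hs6, ht6]
    linear_combination a * hxy
  have hrs : (a / t ^ 3) ^ 2 + (b / s ^ 3) ^ 2 = 1 := by
    field_simp
    have : a ^ 2 * s ^ 6 + b ^ 2 * t ^ 6 = t ^ 6 * s ^ 6 := by
      rw [hs6, ht6]
      linear_combination (-a * b) * hxy
    linear_combination this
  -- The rotation w = m + in is a cube root of p₂ − i p₃; it has modulus 1 because its cube does.
  obtain ⟨w, hw⟩ := IsAlgClosed.exists_pow_nat_eq (⟨a / t ^ 3, -(b / s ^ 3)⟩ : ℂ) (n := 3)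
    (by norm_num)
  obtain ⟨m, n⟩ := w
  have hr := congrArg Complex.re hw
  have hi := congrArg Complex.im hw
  simp [pow_succ] at hr hi
  have hr' : m ^ 3 - 3 * m * n ^ 2 = a / t ^ 3 := by
    rw [show a / t ^ 3 = a / (t * t * t) by ring, ← hr]
    ring
  have hi' : n ^ 3 - 3 * m ^ 2 * n = b / s ^ 3 := by
    rw [show b / s ^ 3 = - -(b / (s * s * s)) by ring, ← hi]
    ring
  have hmn : m ^ 2 + n ^ 2 = 1 := by
    have h3 : (m ^ 2 + n ^ 2) ^ 3 = 1 := by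
      rw [← hrs, ← hr', ← hi']
      ring
    exact (pow_eq_one_iff_of_nonneg (by positivity) (by norm_num)).1 h3
  have hk₁ : z / (s * t) ≠ 0 := by positivity
  have hk₂ : s ^ 2 / t ≠ 0 := by positivity
  have hk₃ : t ^ 2 / s ≠ 0 := by positivity
  let f : Module.Basis (Fin 7) ℝ (tangent base) :=
    Module.Basis.ofEquivFun (baseEquiv.trans (adaptEquiv hk₁ hk₂ hk₃ hmn))
  have hf : ∀ w, (f.coord · w) = adapt (z / (s * t)) (s ^ 2 / t) (t ^ 2 / s) m n
      (baseFrame.coord · w) := by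
    intro w
    ext k
    rw [Module.Basis.coord_apply, Module.Basis.ofEquivFun_repr_apply]
    rfl
  have hf0 : ∀ w, f.coord 0 w = -(z / (s * t) * baseFrame.coord 0 w) := fun w => congrFun (hf w) 0
  have e1 : (s ^ 2 / t) ^ 3 * (a / t ^ 3) = x := by
    field_simp
    linear_combination -hx
  have e2 : (s ^ 2 / t) ^ 2 * (t ^ 2 / s) * (b / s ^ 3) = b := by
    field_simp
  have e3 : (s ^ 2 / t) * (t ^ 2 / s) ^ 2 * (a / t ^ 3) = a := by
    field_simp
  have e4 : (t ^ 2 / s) ^ 3 * (b / s ^ 3) = y := by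
    field_simp
    linear_combination -hy
  have e5 : (s ^ 2 / t) * (t ^ 2 / s) = s * t := by
    field_simp
  refine ⟨f, ?_, ?_⟩
  · rw [g2Model_eq_form3]
    ext w
    rw [form3_apply, form3_apply]
    simp only [hf, inv3, om_adapt hmn, hf0]
    -- The free entry is set to −z so that both coefficient vectors coincide.
    rw [cubic_adapt _ _ _ _ _ _ (-z), hr', hi', e1, e2, e3, e4, e5]
    simp
    field_simp
    ring
  · ext w
    rw [form4_apply, form4_apply]
    simp only [hf, inv4, om_adapt hmn, hf0]
    simp only [cubic_adapt' _ _ _ _ _ _ (dualCoeff a b z s t 0), hr', hi', e5]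
    simp [cubic, dualCoeff]
    field_simp
    ring

end Family

/-! ### Coclosedness, the nearly parallel circle and its injectivity -/

section Coclosed

theorem isInvariant_zero {k : ℕ} : IsInvariant (0 : Form k) := fun _ _ => rfl

theorem IsInvariant.smul {k : ℕ} {α : Form k} (hα : IsInvariant α) (c : ℝ) : IsInvariant (c • α) :=
  fun g p => congrArg (c • ·) (hα g p)

/-- The dual of the form `phi`. -/
def dualForm (a b z s t : ℝ) : Form 4 := invariantForm (form4 baseFrame.coord (dualCoeff a b z s t))

theorem phiBase_stabilizerInvariant {a b x y z : ℝ} (hP : 0 < a ^ 2 + b * y)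
    (hQ : 0 < b ^ 2 + a * x) : IsStabilizerInvariant (phiBase a b x y z) := by
  rw [phiBase_eq hP hQ]
  exact form3_stabilizerInvariant _

theorem isDual_phi {a b x y z s t : ℝ} (hs : 0 < s) (ht : 0 < t) (hz : z ≠ 0)
    (hxy : x * y = a * b) (hs6 : s ^ 6 = b ^ 2 + a * x) (ht6 : t ^ 6 = a ^ 2 + b * y) :
    IsDual (phi a b x y z) (dualForm a b z s t) := by
  have hφ := phiBase_stabilizerInvariant (z := z) (ht6 ▸ pow_pos ht 6) (hs6 ▸ pow_pos hs 6)
  have hψ := form4_stabilizerInvariant (dualCoeff a b z s t)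
  obtain ⟨f, h3, h4⟩ := exists_adapted_basis hs ht hz hxy hs6 ht6
  refine isDual_of_base hφ.isInvariant hψ.isInvariant (f := f) ?_ ?_
  · rw [phi, hφ.invariantForm_base, phiBase_eq (ht6 ▸ pow_pos ht 6) (hs6 ▸ pow_pos hs 6), h3]
  · rw [dualForm, hψ.invariantForm_base, h4]

theorem hasExtDeriv_dualForm (a b z s t : ℝ) : HasExtDeriv (dualForm a b z s t) 0 := by
  have hψ := form4_stabilizerInvariant (dualCoeff a b z s t)
  obtain ⟨τ, hτ⟩ := exists_isLocalExtension hψ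
  exact hasExtDeriv_of_base hψ.isInvariant isInvariant_zero hτ
    (extDeriv_form4 hψ.isInvariant hψ.invariantForm_base hτ)

theorem isCoclosed_phi {a b x y z : ℝ} (hP : 0 < a ^ 2 + b * y) (hQ : 0 < b ^ 2 + a * x)
    (hz : z ≠ 0) (hxy : x * y = a * b) : IsCoclosed (phi a b x y z) := by
  obtain ⟨s, t, hs, ht, hs6, ht6, -⟩ := exists_scales hP hQ
  have hd := isDual_phi hs ht hz hxy hs6 ht6
  exact ⟨⟨isSmooth_invariantForm (phiBase_stabilizerInvariant hP hQ),
    fun p => (hd p).imp fun f hf => hf.1⟩, _, hd, hasExtDeriv_dualForm a b z s t⟩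

theorem isNearlyParallel_phi {a b : ℝ} (hab : a ^ 2 + b ^ 2 = 27 / 512) :
    IsNearlyParallel (phi a b a b (-9 / 32)) := by
  have hP : 0 < a ^ 2 + b * b := by nlinarith
  have hQ : 0 < b ^ 2 + a * a := by nlinarith
  -- Both radicands equal 27/512 = (3/8)³, so s = t = √(3/8).
  have hs : 0 < √(3 / 8 : ℝ) := by positivity
  have hs2 : √(3 / 8 : ℝ) * √(3 / 8 : ℝ) = 3 / 8 := Real.mul_self_sqrt (by norm_num)
  set s := √(3 / 8 : ℝ)
  have hs6 : s ^ 6 = 27 / 512 := by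
    rw [show s ^ 6 = (s * s) ^ 3 by ring, hs2]
    norm_num
  refine ⟨isCoclosed_phi hP hQ (by norm_num) rfl, dualForm a b (-9 / 32) s s,
    isDual_phi hs hs (by norm_num) rfl (by linarith) (by linarith), ?_⟩
  have hφ := phiBase_stabilizerInvariant (z := -9 / 32) hP hQ
  have hψ := form4_stabilizerInvariant (dualCoeff a b (-9 / 32) s s)
  obtain ⟨τ, hτ⟩ := exists_isLocalExtension hφ
  refine hasExtDeriv_of_base hφ.isInvariant (hψ.isInvariant.smul 4) hτ ?_
  rw [extDeriv_form3 hφ.isInvariant (hφ.invariantForm_base.trans (phiBase_eq hP hQ)) hτ]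
  change _ = (4 : ℝ) • invariantForm _ base
  rw [hψ.invariantForm_base]
  -- Two conditions are met by z = −9/32: −2z = 4s⁴ for the coefficient of ω²/2, and −4z/s² = 3 for
  -- the cubics.
  have hq : dCoeff ![-(-9 / 32), a, b, -a, -b] = fun i => 4 * dualCoeff a b (-9 / 32) s s i := by
    have h3 : s ^ 3 ≠ 0 := by positivity
    ext i
    fin_cases i <;> simp [dCoeff, dualCoeff, hs2, h3, mul_div_cancel_left₀] <;> ring
  rw [hq]
  simp only [form4, Finset.smul_sum, smul_smul, mul_assoc]

/-- The values on (e_2, e_3, e_4) and (e_5, e_6, e_7) are a and −b. -/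
theorem injOn_phi (z : ℝ) {r : ℝ} (hr : 0 < r) :
    Set.InjOn (fun c : ℝ × ℝ => phi c.1 c.2 c.1 c.2 z) {c : ℝ × ℝ | c.1 ^ 2 + c.2 ^ 2 = r} := by
  have key : ∀ c : ℝ × ℝ, c.1 ^ 2 + c.2 ^ 2 = r →
      phi c.1 c.2 c.1 c.2 z base = form3 baseFrame.coord ![-z, c.1, c.2, -c.1, -c.2] := by
    intro c hc
    have hP : 0 < c.1 ^ 2 + c.2 * c.2 := by linarith
    have hQ : 0 < c.2 ^ 2 + c.1 * c.1 := by linarith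
    rw [phi, (phiBase_stabilizerInvariant hP hQ).invariantForm_base, phiBase_eq hP hQ]
  intro c hc d hd h
  have h' := congrFun h base
  simp only [key c hc, key d hd] at h'
  have h1 := DFunLike.congr_fun h' (baseFrame ∘ ![1, 2, 3])
  have h2 := DFunLike.congr_fun h' (baseFrame ∘ ![4, 5, 6])
  have t1 : (fun m => table3 m ![1, 2, 3]) = ![0, 1, 0, 0, 0] := by decide
  have t2 : (fun m => table3 m ![4, 5, 6]) = ![0, 0, 0, 0, 1] := by decide
  simp only [form3_basis, congrFun t1, congrFun t2] at h1 h2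
  simp [Fin.sum_univ_five] at h1 h2
  exact Prod.ext h1 h2

end Coclosed

/-! ### Nondegeneracy of G₂-forms and Hessians of binary cubics -/

section Nondegeneracy

/-- The identity |u × w|² = |u|²|w|² − ⟨u, w⟩² for the seven-dimensional cross product. -/
theorem sum_inv3_sq (u w : Fin 7 → ℝ) :
    ∑ k, inv3 ![1, 1, 0, -1, 0] u w (Pi.single k 1) ^ 2 =
      (∑ i, u i ^ 2) * (∑ i, w i ^ 2) - (∑ i, u i * w i) ^ 2 := by
  simp [Fin.sum_univ_seven, inv3, cubic, tri, det3, om]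
  ring

theorem exists_smul_of_g2Model {W : Type*} [AddCommGroup W] [Module ℝ W]
    (f : Module.Basis (Fin 7) ℝ W) {u w : W} (hu : u ≠ 0)
    (h : ∀ x, g2Model f ![u, w, x] = 0) : ∃ c : ℝ, w = c • u := by
  set U : Fin 7 → ℝ := (f.coord · u) with hU
  set V : Fin 7 → ℝ := (f.coord · w) with hV
  have h0 : (∑ i, U i ^ 2) * (∑ i, V i ^ 2) - (∑ i, U i * V i) ^ 2 = 0 := by
    rw [← sum_inv3_sq]
    refine Finset.sum_eq_zero fun k _ => ?_
    have hk := h (f k)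
    rw [g2Model_eq_form3, form3_apply] at hk
    have he : (f.coord · (f k)) = (Pi.single k 1 : Fin 7 → ℝ) := by
      ext i
      simp [Finsupp.single_apply, Pi.single_apply, eq_comm]
    rw [pow_eq_zero_iff two_ne_zero, ← he]
    exact hk
  have hpos : 0 < ∑ i, U i ^ 2 := by
    refine lt_of_le_of_ne (Finset.sum_nonneg fun i _ => sq_nonneg _) fun h1 => hu ?_
    have h2 := (Finset.sum_eq_zero_iff_of_nonneg fun i _ => sq_nonneg (U i)).1 h1.symm
    refine f.ext_elem fun i => ?_
    simpa [hU] using h2 i (Finset.mem_univ i)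
  -- Equality in Cauchy–Schwarz: the component of w orthogonal to u vanishes.
  have h3 : ∑ k, ((∑ i, U i ^ 2) * V k - (∑ i, U i * V i) * U k) ^ 2 = 0 := by
    have : ∑ k, ((∑ i, U i ^ 2) * V k - (∑ i, U i * V i) * U k) ^ 2 =
        (∑ i, U i ^ 2) * ((∑ i, U i ^ 2) * (∑ i, V i ^ 2) - (∑ i, U i * V i) ^ 2) := by
      simp only [Fin.sum_univ_seven]
      ring
    rw [this, h0, mul_zero]
  refine ⟨(∑ i, U i * V i) / ∑ i, U i ^ 2, f.ext_elem fun k => ?_⟩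
  have h4 := (Finset.sum_eq_zero_iff_of_nonneg fun k _ => sq_nonneg _).1 h3 k (Finset.mem_univ k)
  rw [pow_eq_zero_iff two_ne_zero, sub_eq_zero] at h4
  change V k = _
  rw [map_smul, Finsupp.smul_apply, smul_eq_mul]
  change V k = _ * U k
  rw [div_mul_eq_mul_div, eq_div_iff hpos.ne', ← h4, mul_comm]

/-- A zero (s, t) of the Hessian makes the polarised cubic singular, with kernel vector p. Then s
e_2 + t e_5 and p_0 e_3 + p_1 e_6 are independent, but the 3-form vanishes on them with any third
argument: the cubic by the choice of p, and ω because the two vectors lie over different axes of ℝ³.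
-/
theorem hessian_ne_zero {W : Type*} [AddCommGroup W] [Module ℝ W]
    {e f : Module.Basis (Fin 7) ℝ W} {q : Fin 5 → ℝ} (h : form3 e.coord q = g2Model f) {s t : ℝ}
    (hst : s ≠ 0 ∨ t ≠ 0) :
    (q 1 * q 3 - q 2 ^ 2) * s ^ 2 + (q 1 * q 4 - q 2 * q 3) * (s * t)
      + (q 2 * q 4 - q 3 ^ 2) * t ^ 2 ≠ 0 := by
  intro h0
  have hdet : !![q 1 * s + q 2 * t, q 2 * s + q 3 * t; q 2 * s + q 3 * t, q 3 * s + q 4 * t].det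
      = 0 := by
    rw [Matrix.det_fin_two_of]
    linear_combination h0
  obtain ⟨p, hp, hp0⟩ := Matrix.exists_mulVec_eq_zero_iff.2 hdet
  have hp1 := congrFun hp0 0
  have hp2 := congrFun hp0 1
  simp [Matrix.mulVec, dotProduct, Fin.sum_univ_two] at hp1 hp2
  have hu : (e.coord · (s • e 1 + t • e 4)) = ![0, s, 0, 0, t, 0, 0] := by
    ext i
    fin_cases i <;> simp
  have hw : (e.coord · (p 0 • e 2 + p 1 • e 5)) = ![0, 0, p 0, 0, 0, p 1, 0] := by
    ext i
    fin_cases i <;> simp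
  have hu0 : s • e 1 + t • e 4 ≠ 0 := by
    intro h1
    rw [h1] at hu
    have h2 := congrFun hu 1
    have h3 := congrFun hu 4
    simp at h2 h3
    rcases hst with h4 | h4
    exacts [h4 h2.symm, h4 h3.symm]
  obtain ⟨c, hc⟩ := exists_smul_of_g2Model f (w := p 0 • e 2 + p 1 • e 5) hu0 fun x => by
    rw [← h, form3_apply]
    simp only [Matrix.cons_val_zero, Matrix.cons_val_one, Matrix.cons_val, hu, hw]
    simp [inv3, cubic, tri, det3, om]
    linear_combination (e.repr x 3) * hp1 + (e.repr x 6) * hp2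
  have h5 : ∀ i, ![0, 0, p 0, 0, 0, p 1, 0] i = c * ![0, s, 0, 0, t, 0, 0] i := fun i => by
    rw [← hu, ← hw]
    exact (congrArg (e.coord i) hc).trans (map_smul _ _ _)
  have h6 := h5 2
  have h7 := h5 5
  simp at h6 h7
  apply hp
  ext i
  fin_cases i
  exacts [h6, h7]

/-- A binary cubic whose Hessian is definite has negative definite Hessian. -/
theorem hessian_trace_neg {a b c d : ℝ} (h : ∀ s t : ℝ, s ≠ 0 ∨ t ≠ 0 →
    (a * c - b ^ 2) * s ^ 2 + (a * d - b * c) * (s * t) + (b * d - c ^ 2) * t ^ 2 ≠ 0) :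
    (a * c - b ^ 2) + (b * d - c ^ 2) < 0 := by
  set A := a * c - b ^ 2 with hA
  set B := a * d - b * c with hB
  set C := b * d - c ^ 2 with hC
  have hA0 : A ≠ 0 := by simpa using h 1 0 (by simp)
  have hdisc : B ^ 2 < 4 * A * C := by
    by_contra! hd
    -- The quadratic formula yields a nontrivial real zero of the Hessian.
    refine h (-B + √(B ^ 2 - 4 * A * C)) (2 * A) (Or.inr (by simpa using hA0)) ?_
    linear_combination A * Real.sq_sqrt (sub_nonneg.2 hd)
  have hAC : 0 < A * C := by nlinarith [sq_nonneg B]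
  by_contra! hpos
  have hA1 : 0 < A := by
    rcases lt_or_gt_of_ne hA0 with h1 | h1
    · nlinarith
    · exact h1
  have hC1 : 0 < C := by nlinarith
  have hb : 0 < b ^ 2 := by
    refine lt_of_le_of_ne (sq_nonneg b) fun hb => ?_
    have : b = 0 := by simpa using hb.symm
    rw [hC, this] at hC1
    nlinarith [sq_nonneg c]
  -- Squaring this syzygy gives b²B² ≥ 4(A + b²)AC, against b²B² < 4b²AC when A, C > 0.
  have hsyz : b * B = a * C + c * A := by
    rw [hA, hB, hC]
    ring
  have h1 : b ^ 2 * B ^ 2 < b ^ 2 * (4 * A * C) := mul_lt_mul_of_pos_left hdisc hb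
  have h2 : b ^ 2 * B ^ 2 = (a * C - c * A) ^ 2 + 4 * (A + b ^ 2) * (A * C) := by
    have : A + b ^ 2 = a * c := by rw [hA]; ring
    rw [← mul_pow, hsyz, this]
    ring
  nlinarith [sq_nonneg (a * C - c * A), mul_pos hA1 hAC]

end Nondegeneracy

/-! ### Classification of invariant 3-forms and the obstruction -/

section InvariantThreeForms

/-- The rotation given by an integral matrix. -/
def intRot (M : Matrix (Fin 5) (Fin 5) ℤ) (h : M * Mᵀ = 1) (hd : M.det = 1) : SO5 :=
  ⟨M.map (Int.castRingHom ℝ), Matrix.mem_specialOrthogonalGroup_iff.2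
    ⟨(Matrix.mem_orthogonalGroup_iff (Fin 5) ℝ).2 (by
      change _ * (M.map (Int.castRingHom ℝ))ᵀ = 1
      rw [← Matrix.transpose_map, ← Matrix.map_mul, h, Matrix.map_one _ (map_zero _) (map_one _)]),
    by
      rw [← RingHom.mapMatrix_apply, ← RingHom.map_det, hd, map_one]⟩⟩

theorem IsInvariant.apply_baseFrame {α : Form 3} (hα : IsInvariant α) {g : SO5}
    (hg : act g.1 base.1 = base.1) {ε : Fin 7 → ℤ} {σ : Fin 7 → Fin 7}
    (hf : ∀ i, act g.1 (baseFrame i) = (ε i : ℝ) • (baseFrame (σ i) : Amb)) (v : Fin 3 → Fin 7) :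
    (∏ j, (ε (v j) : ℝ)) * α base (baseFrame ∘ σ ∘ v) = α base (baseFrame ∘ v) := by
  have h := hα.comp_dRot (Subtype.ext hg : rot g base = base)
  conv_rhs => rw [← h]
  rw [AlternatingMap.compLinearMap_apply, ← smul_eq_mul, ← AlternatingMap.map_smul_univ]
  congr 1
  ext1 i
  exact Subtype.ext (hf (v i)).symm

theorem IsInvariant.apply_baseFrame_half_turn {α : Form 3} (hα : IsInvariant α) (v : Fin 3 → Fin 7) :
    (∏ j, (((![1, 1, -1, -1, 1, -1, -1] : Fin 7 → ℤ) (v j) : ℤ) : ℝ)) * α base (baseFrame ∘ v) =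
      α base (baseFrame ∘ v) := by
  refine hα.apply_baseFrame (σ := id)
    (g := intRot (Matrix.diagonal ![1, 1, 1, -1, -1]) (by decide) (by decide +kernel)) ?_ ?_ v
  · refine Prod.ext ?_ ?_ <;> ext j <;> fin_cases j <;> simp [intRot, act_apply, base, dotProduct]
  · intro i
    simp only [baseFrame, Module.Basis.coe_ofEquivFun, act_apply, baseEquiv_symm_apply]
    refine Prod.ext ?_ ?_ <;> ext j <;> fin_cases i <;> fin_cases j <;>
      simp [intRot, Matrix.mulVec, dotProduct, Matrix.diagonal_apply]

theorem IsInvariant.apply_baseFrame_half_turn' {α : Form 3} (hα : IsInvariant α)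
    (v : Fin 3 → Fin 7) :
    (∏ j, (((![1, -1, -1, 1, -1, -1, 1] : Fin 7 → ℤ) (v j) : ℤ) : ℝ)) * α base (baseFrame ∘ v) =
      α base (baseFrame ∘ v) := by
  refine hα.apply_baseFrame (σ := id)
    (g := intRot (Matrix.diagonal ![1, 1, -1, -1, 1]) (by decide) (by decide +kernel)) ?_ ?_ v
  · refine Prod.ext ?_ ?_ <;> ext j <;> fin_cases j <;> simp [intRot, act_apply, base, dotProduct]
  · intro i
    simp only [baseFrame, Module.Basis.coe_ofEquivFun, act_apply, baseEquiv_symm_apply]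
    refine Prod.ext ?_ ?_ <;> ext j <;> fin_cases i <;> fin_cases j <;>
      simp [intRot, Matrix.mulVec, dotProduct, Matrix.diagonal_apply]

theorem IsInvariant.apply_baseFrame_cycle {α : Form 3} (hα : IsInvariant α) (v : Fin 3 → Fin 7) :
    α base (baseFrame ∘ ![0, 2, 3, 1, 5, 6, 4] ∘ v) = α base (baseFrame ∘ v) := by
  have h := hα.apply_baseFrame (σ := ![0, 2, 3, 1, 5, 6, 4]) (ε := fun _ => 1)
    (g := intRot !![1, 0, 0, 0, 0; 0, 1, 0, 0, 0; 0, 0, 0, 0, 1; 0, 0, 1, 0, 0; 0, 0, 0, 1, 0]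
      (by decide) (by decide +kernel)) ?_ ?_ v
  · simpa using h
  · refine Prod.ext ?_ ?_ <;> ext j <;> fin_cases j <;> simp [intRot, act_apply, base, dotProduct]
  · intro i
    simp only [baseFrame, Module.Basis.coe_ofEquivFun, act_apply, baseEquiv_symm_apply]
    refine Prod.ext ?_ ?_ <;> ext j <;> fin_cases i <;> fin_cases j <;>
      simp [intRot, Matrix.mulVec, dotProduct, Fin.sum_univ_five]

theorem index3_table : ∀ i j k : Fin 7, i < j → j < k →
    (((∏ l, (![1, 1, -1, -1, 1, -1, -1] : Fin 7 → ℤ) (![i, j, k] l) = -1 ∨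
      ∏ l, (![1, -1, -1, 1, -1, -1, 1] : Fin 7 → ℤ) (![i, j, k] l) = -1) ∧
      ∀ m, table3 m ![i, j, k] = 0) ∨
    ∃ n, ![i, j, k] = index3 n ∧
      ∀ m, table3 m (index3 n) = if m = kind n then sign3 n else 0) := by
  decide +kernel

/-- Two half turns and a cyclic permutation of the last three axes already suffice. A monomial
outside the list changes sign under one of the half turns, and the cyclic permutation identifies the
coefficients of each kind. -/
theorem exists_form3_of_isInvariant {α : Form 3} (hα : IsInvariant α) :
    ∃ q, α base = form3 baseFrame.coord q := by
  let A : (Fin 3 → Fin 7) → ℝ := fun v => α base (baseFrame ∘ v)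
  have hcyc : ∀ v, A (![0, 2, 3, 1, 5, 6, 4] ∘ v) = A v := hα.apply_baseFrame_cycle
  have hswap : ∀ i j k, A ![i, j, k] = -A ![j, i, k] ∧ A ![i, j, k] = -A ![i, k, j] := by
    intro i j k
    have s1 := (α base).map_swap (baseFrame ∘ ![j, i, k]) (i := 0) (j := 1) (by decide)
    have s2 := (α base).map_swap (baseFrame ∘ ![i, k, j]) (i := 1) (j := 2) (by decide)
    refine ⟨Eq.trans (congrArg _ ?_) s1, Eq.trans (congrArg _ ?_) s2⟩ <;>
      (ext1 l; fin_cases l <;> rfl)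
  have c1 : A ![0, 2, 5] = A ![0, 1, 4] := by
    rw [← hcyc ![0, 1, 4]]
    congr 1
    decide
  have c2 : A ![0, 3, 6] = A ![0, 2, 5] := by
    rw [← hcyc ![0, 2, 5]]
    congr 1
    decide
  have c3 : A ![2, 3, 4] = A ![1, 2, 6] := by
    rw [← hcyc ![1, 2, 6]]
    congr 1
    decide
  have c4 : A ![1, 3, 5] = -A ![2, 3, 4] := by
    rw [← hcyc ![2, 3, 4], (hswap 1 3 5).1]
    congr 2
    decide
  have c5 : A ![2, 4, 6] = -A ![1, 5, 6] := by
    rw [← hcyc ![1, 5, 6], (hswap 2 4 6).2]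
    congr 2
    decide
  have c6 : A ![3, 4, 5] = -A ![2, 4, 6] := by
    rw [← hcyc ![2, 4, 6], (hswap 3 4 5).2]
    congr 2
    decide
  refine ⟨![A ![0, 1, 4], A ![1, 2, 3], A ![1, 2, 6], A ![1, 5, 6], A ![4, 5, 6]],
    ext_strictMono baseFrame fun v hv => ?_⟩
  have hv' : v = ![v 0, v 1, v 2] := by
    ext i
    fin_cases i <;> rfl
  rw [form3_basis]
  change A v = _
  have T := index3_table (v 0) (v 1) (v 2) (hv (by decide)) (hv (by decide))
  rw [← hv'] at T
  rcases T with ⟨hs, ht⟩ | ⟨n, rfl, hn⟩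
  · simp only [ht, Int.cast_zero, mul_zero, Finset.sum_const_zero]
    rcases hs with hs | hs
    · have := hα.apply_baseFrame_half_turn v
      rw [← Int.cast_prod, hs] at this
      have h' : -A v = A v := by simpa using this
      linarith
    · have := hα.apply_baseFrame_half_turn' v
      rw [← Int.cast_prod, hs] at this
      have h' : -A v = A v := by simpa using this
      linarith
  · simp only [hn, Int.cast_ite, Int.cast_zero, mul_ite, mul_zero, Finset.sum_ite_eq',
      Finset.mem_univ, if_true]
    fin_cases n <;> simp [index3, kind, sign3] <;> linarith

theorem pairing_eq_zero {W : Type*} [AddCommGroup W] [Module ℝ W]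
    (f : Module.Basis (Fin 7) ℝ W) {p q : Fin 5 → ℝ}
    (h : wedge (form4 f.coord p) (form3 f.coord q) = 0) :
    -3 * p 0 * q 0 + p 1 * q 4 - 3 * p 2 * q 3 + 3 * p 3 * q 2 - p 4 * q 1 = 0 := by
  rw [← wedge_form4_form3 f, h]
  rfl

/-- There is no invariant purely coclosed structure. -/
theorem not_exists_isPurelyCoclosed : ¬ ∃ φ : Form 3, IsInvariant φ ∧ IsPurelyCoclosed φ := by
  rintro ⟨φ, hφ, ⟨⟨-, hf⟩, -⟩, β, hβ, hw⟩
  obtain ⟨f, hf⟩ := hf base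
  obtain ⟨q, hq⟩ := exists_form3_of_isInvariant hφ
  obtain ⟨τ, hτ, hβ⟩ := hβ base
  have hneg := hessian_trace_neg fun s t hst => hessian_ne_zero (hq.symm.trans hf) hst
  have hb : β base = form4 baseFrame.coord (dCoeff q) := hβ.trans (extDeriv_form3 hφ hq hτ)
  have hzero : wedge (form4 baseFrame.coord (dCoeff q)) (form3 baseFrame.coord q) = 0 :=
    (congrArg₂ wedge hb hq).symm.trans (hw base)
  -- The left-hand side is 6(tr H − q_0²), negative by `hneg`.
  have h0 : -3 * (2 * q 0) * q 0 + 3 * q 2 * q 4 - 3 * (2 * q 3 - q 1) * q 3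
      + 3 * (q 4 - 2 * q 2) * q 2 - -3 * q 3 * q 1 = 0 := pairing_eq_zero baseFrame hzero
  nlinarith [sq_nonneg (q 0)]

end InvariantThreeForms

end StiefelG2

end

theorem mainTheorem1 :
    (∀ a b x y z : ℝ, 0 < a ^ 2 + b * y → 0 < b ^ 2 + a * x → z ≠ 0 → x * y = a * b →
      StiefelG2.IsInvariant (StiefelG2.phi a b x y z) ∧
      StiefelG2.phi a b x y z StiefelG2.base = StiefelG2.phiBase a b x y z ∧
      StiefelG2.IsCoclosed (StiefelG2.phi a b x y z)) ∧
    (¬ ∃ φ : StiefelG2.Form 3, StiefelG2.IsInvariant φ ∧ StiefelG2.IsPurelyCoclosed φ) ∧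
    (∀ a b x y z : ℝ, x = a → y = b → a ^ 2 + b ^ 2 = 27 / 512 → z = -9 / 32 →
      StiefelG2.IsNearlyParallel (StiefelG2.phi a b x y z)) ∧
    Set.InjOn (fun c : ℝ × ℝ => StiefelG2.phi c.1 c.2 c.1 c.2 (-9 / 32))
      {c : ℝ × ℝ | c.1 ^ 2 + c.2 ^ 2 = 27 / 512} := by
  refine ⟨fun a b x y z hP hQ hz hxy => ?_, StiefelG2.not_exists_isPurelyCoclosed, ?_,
    StiefelG2.injOn_phi _ (by norm_num)⟩
  · have h := StiefelG2.phiBase_stabilizerInvariant (z := z) hP hQ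
    exact ⟨h.isInvariant, h.invariantForm_base, StiefelG2.isCoclosed_phi hP hQ hz hxy⟩
  · rintro a b _ _ _ rfl rfl hab rfl
    exact StiefelG2.isNearlyParallel_phi hab
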